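/- A Seidel matrix of order $n$ is a real symmetric $n\times n$ matrix $S$ with $S_{ii}=0$ for all $i$ and $S_{ij}\in\{1,-1\}$ for all $i\neq j$. Its graph $G(S)$ is the graph on $\{1,\dots,n\}$ in which distinct $i,j$ are adjacent if and only if $S_{ij}=-1$; conversely, a graph $G$ on $\{1,\dots,n\}$ with adjacency matrix $A(G)$ has the Seidel matrix $S(G)=\mathbf{J}-\mathbf{I}-2A(G)$, where $\mathbf{J}$ is the all-ones matrix and $\mathbf{I}$ the identity matrix. For $U\subseteq\{1,\dots,n\}$ let $D_U$ be the diagonal matrix with $(D_U)_{ii}=1$ if $i\in U$ and $(D_U)_{ii}=-1$ if $i\notin U$. The switching class of $S$ is the set of all graphs $G(D_U\,S\,D_U)$ with $U\subseteq\{1,\dots,n\}$. Theorem. Let $S$ be a Seidel matrix of order $n\geq 277$ whose smallest eigenvalue is $-5$. Assume that the switching class of $S$ contains a triangle-free graph. Then $$\operatorname{rk}(S+5\mathbf{I})\ \geq\ \frac{2n}{3}+1 .$$ -/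

import Mathlib

/-- A Seidel matrix: a real symmetric matrix with `0` on the diagonal and `1` or `-1` in every
off-diagonal position. -/
structure IsSeidelMatrix {n : ℕ} (S : Matrix (Fin n) (Fin n) ℝ) : Prop where
  symm : S.IsSymm
  diag : ∀ i, S i i = 0
  off_diag : ∀ i j, i ≠ j → S i j = 1 ∨ S i j = -1

/-- The graph `G(S)` of a Seidel matrix: distinct `i`, `j` are adjacent iff `S i j = -1`
(for a symmetric `S` the symmetrization built into `fromRel` has no effect). -/
def graphOfSeidel {n : ℕ} (S : Matrix (Fin n) (Fin n) ℝ) : SimpleGraph (Fin n) :=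
  SimpleGraph.fromRel (fun i j => S i j = -1)

open scoped Classical in
/-- The Seidel matrix `S(G) = J - I - 2 A(G)` of a graph `G`. -/
noncomputable def seidelOfGraph {n : ℕ} (G : SimpleGraph (Fin n)) : Matrix (Fin n) (Fin n) ℝ :=
  Matrix.of (fun _ _ => (1 : ℝ)) - 1 - (2 : ℝ) • G.adjMatrix ℝ

open scoped Classical in
/-- The diagonal matrix `D_U` with entry `1` at the elements of `U` and `-1` elsewhere. -/
noncomputable def switchingDiagonal {n : ℕ} (U : Set (Fin n)) : Matrix (Fin n) (Fin n) ℝ :=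
  Matrix.diagonal (fun i => if i ∈ U then 1 else -1)

/-- The matrix `S_sw(U) = D_U S D_U`, obtained from `S` by switching with respect to `U`. -/
noncomputable def switchMatrix {n : ℕ} (S : Matrix (Fin n) (Fin n) ℝ) (U : Set (Fin n)) :
    Matrix (Fin n) (Fin n) ℝ :=
  switchingDiagonal U * S * switchingDiagonal U

/-- The graph `G_sw(U) = G(S(G)_sw(U))`, obtained from `G` by switching with respect to `U`. -/
noncomputable def switchGraph {n : ℕ} (G : SimpleGraph (Fin n)) (U : Set (Fin n)) :
    SimpleGraph (Fin n) :=
  graphOfSeidel (switchMatrix (seidelOfGraph G) U)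

/-- The switching class `[G]` of a graph: all graphs obtained from `G` by switching. -/
def switchingClass {n : ℕ} (G : SimpleGraph (Fin n)) : Set (SimpleGraph (Fin n)) :=
  {H | ∃ U : Set (Fin n), H = switchGraph G U}

/-- The switching class `[S] = [G(S)]` of a Seidel matrix. -/
def seidelSwitchingClass {n : ℕ} (S : Matrix (Fin n) (Fin n) ℝ) : Set (SimpleGraph (Fin n)) :=
  switchingClass (graphOfSeidel S)

/-- `μ` is the smallest (real) eigenvalue of `M`. -/
def IsSmallestEigenvalue {n : ℕ} (M : Matrix (Fin n) (Fin n) ℝ) (μ : ℝ) : Prop :=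
  IsLeast {lam : ℝ | Module.End.HasEigenvalue (Matrix.toLin' M) lam} μ

/-! ### The adjacency form and the quadratic form of the Gram matrix. -/

section Forms

open scoped Classical

variable {V : Type*} [Fintype V]

/-! Switching conjugates `S + 5I` by a diagonal sign matrix, so it preserves rank and positive
semidefiniteness, and one may take `G` itself triangle-free with `4I - 2A + J` positive
semidefinite. Hence `A ≤ 2` as a form on vectors of coordinate sum zero: `A` has at most one
eigenvalue above 2. The target is `3n ≤ 4 rk + 78`.

Suppose first that `A ≤ 2` everywhere. A kernel vector then has coordinate sum zero and is an
eigenvector of `A` for the eigenvalue 2. By a Perron-Frobenius argument each component contributes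
at most one dimension to the kernel, and triangle-freeness forces a contributing component to have
at least four vertices. So the nullity is at most `n/4` (`rank_seidelGram_of_adjBilin_le`).

If all degrees are at most 28, testing on stars lowers the bound to 4 (`degree_le_four`). Two
mutually separated pieces cannot both exceed the eigenvalue 2, so deleting the surroundings of one
extended Dynkin configuration (a vertex of degree 4, or two branch vertices joined by a path) leaves
`A ≤ 2`; if no such configuration exists, one vertex suffices. At most 20 vertices are lost
(`exists_deletion`), at a cost of 60 in the inequality.

If some degree is at least 29, let `I` be the independent neighbourhood of a vertex of maximum
degree. Every other vertex sees almost none or almost all of `I`. Counting shows that at most 6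
vertices are of the first kind; deleting them and switching at the second kind gives a bipartite
graph with degrees at most 28, to which the first case applies. The extra cost is 18
(`three_mul_card_le_of_large_degree`). -/

/-- The Gram matrix `S(G) + 5 I` of the equiangular system attached to a graph. -/
noncomputable def seidelGram (G : SimpleGraph V) : Matrix V V ℝ :=
  Matrix.of fun v w => if v = w then 5 else if G.Adj v w then -1 else 1

/-- The bilinear form of the adjacency matrix. -/
noncomputable def adjBilin (G : SimpleGraph V) : LinearMap.BilinForm ℝ (V → ℝ) :=
  Matrix.toBilin' (Matrix.of fun v w => if G.Adj v w then (1 : ℝ) else 0)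

/-- The indicator vector of a finite set. -/
noncomputable def indVec (s : Finset V) : V → ℝ := fun v => if v ∈ s then 1 else 0

lemma adjBilin_apply (G : SimpleGraph V) (x y : V → ℝ) :
    adjBilin G x y = ∑ v, x v * ∑ w ∈ G.neighborFinset v, y w := by
  rw [adjBilin, Matrix.toBilin'_apply]
  refine Finset.sum_congr rfl fun v _ => ?_
  rw [Finset.mul_sum, SimpleGraph.neighborFinset_eq_filter, Finset.sum_filter]
  refine Finset.sum_congr rfl fun w _ => ?_
  by_cases h : G.Adj v w <;> simp [h]

lemma adjBilin_apply' (G : SimpleGraph V) (x y : V → ℝ) :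
    adjBilin G x y = ∑ v, ∑ w, if G.Adj v w then x v * y w else 0 := by
  rw [adjBilin, Matrix.toBilin'_apply]
  refine Finset.sum_congr rfl fun v _ => Finset.sum_congr rfl fun w _ => ?_
  by_cases h : G.Adj v w <;> simp [h]

lemma adjBilin_comm (G : SimpleGraph V) (x y : V → ℝ) : adjBilin G x y = adjBilin G y x := by
  rw [adjBilin_apply', adjBilin_apply', Finset.sum_comm]
  refine Finset.sum_congr rfl fun v _ => Finset.sum_congr rfl fun w _ => ?_
  simp only [G.adj_comm v w, mul_comm]

lemma adjBilin_nonneg (G : SimpleGraph V) {x y : V → ℝ} (hx : 0 ≤ x) (hy : 0 ≤ y) :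
    0 ≤ adjBilin G x y := by
  rw [adjBilin_apply]
  exact Finset.sum_nonneg fun v _ => mul_nonneg (hx v) (Finset.sum_nonneg fun w _ => hy w)

lemma adjBilin_eq_zero (G : SimpleGraph V) {x y : V → ℝ}
    (h : ∀ v w, G.Adj v w → x v ≠ 0 → y w = 0) : adjBilin G x y = 0 := by
  rw [adjBilin_apply']
  refine Finset.sum_eq_zero fun v _ => Finset.sum_eq_zero fun w _ => ?_
  split_ifs with hvw
  · by_cases hx : x v = 0
    · simp [hx]
    · simp [h v w hvw hx]
  · rfl

lemma indVec_nonneg {V : Type*} (s : Finset V) : 0 ≤ indVec s := fun v => by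
  unfold indVec; split_ifs <;> simp

lemma sum_indVec (s : Finset V) : ∑ v, indVec s v = s.card := by
  simp [indVec]

lemma dot_indVec (s : Finset V) (x : V → ℝ) : indVec s ⬝ᵥ x = ∑ v ∈ s, x v := by
  simp [indVec, dotProduct, Finset.sum_ite_mem]

lemma indVec_dot_indVec (s t : Finset V) : indVec s ⬝ᵥ indVec t = ((s ∩ t).card : ℝ) := by
  rw [dot_indVec]; simp [indVec, Finset.sum_ite_mem]

lemma adjBilin_indVec (G : SimpleGraph V) (s : Finset V) (x : V → ℝ) :
    adjBilin G (indVec s) x = ∑ v ∈ s, ∑ w ∈ G.neighborFinset v, x w := by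
  rw [adjBilin_apply]
  simp [indVec, Finset.sum_ite_mem]

lemma adjBilin_indVec_indVec (G : SimpleGraph V) (s t : Finset V) :
    adjBilin G (indVec s) (indVec t) = ∑ v ∈ s, ((G.neighborFinset v ∩ t).card : ℝ) := by
  rw [adjBilin_indVec]
  refine Finset.sum_congr rfl fun v _ => ?_
  simp [indVec, Finset.sum_ite_mem]

/-- This is the identity `S(G) + 5I = 4I - 2A + J` read as quadratic forms. -/
lemma dot_seidelGram (G : SimpleGraph V) (x : V → ℝ) :
    x ⬝ᵥ (seidelGram G).mulVec x = 4 * (x ⬝ᵥ x) - 2 * adjBilin G x x + (∑ v, x v) ^ 2 := by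
  rw [adjBilin_apply', dotProduct, dotProduct, sq, Finset.sum_mul_sum]
  simp only [Matrix.mulVec, dotProduct, Finset.mul_sum, ← Finset.sum_sub_distrib,
    ← Finset.sum_add_distrib]
  refine Finset.sum_congr rfl fun v _ => ?_
  have h4 : 4 * (x v * x v) = ∑ w, if v = w then 4 * (x v * x w) else 0 := by simp
  rw [h4, ← Finset.sum_sub_distrib, ← Finset.sum_add_distrib]
  refine Finset.sum_congr rfl fun w _ => ?_
  by_cases h : v = w
  · subst h; simp [seidelGram]; ring
  · by_cases h' : G.Adj v w <;> simp [seidelGram, h, h'] ; ring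

/-- The quadratic inequality satisfied by the adjacency form when the Gram matrix is positive
semidefinite. -/
lemma adjBilin_le (G : SimpleGraph V) (hG : (seidelGram G).PosSemidef) (x : V → ℝ) :
    2 * adjBilin G x x ≤ 4 * (x ⬝ᵥ x) + (∑ v, x v) ^ 2 := by
  have h := hG.dotProduct_mulVec_nonneg x
  rw [star_trivial, dot_seidelGram] at h
  linarith

/-- Sum `2 x_v x_w ≤ x_v² + x_w²` over the edges. Only degrees on the support of `x` enter, which
allows the bound to be used on part of a graph. -/
lemma adjBilin_self_le_degree (G : SimpleGraph V) (D : ℕ) (x : V → ℝ)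
    (h : ∀ v, x v ≠ 0 → G.degree v ≤ D) : adjBilin G x x ≤ D * (x ⬝ᵥ x) := by
  have key : 2 * adjBilin G x x ≤ 2 * ∑ v, (G.degree v : ℝ) * (x v * x v) := by
    have e1 : ∑ v, (G.degree v : ℝ) * (x v * x v) = ∑ v, ∑ w, if G.Adj v w then x v * x v else 0 := by
      refine Finset.sum_congr rfl fun v _ => ?_
      rw [← Finset.sum_filter, ← SimpleGraph.neighborFinset_eq_filter]
      simp
    have e2 : ∑ v, ∑ w, (if G.Adj v w then x v * x v else 0)
        = ∑ v, ∑ w, if G.Adj v w then x w * x w else 0 := by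
      rw [Finset.sum_comm]
      refine Finset.sum_congr rfl fun v _ => Finset.sum_congr rfl fun w _ => ?_
      simp only [G.adj_comm v w]
    rw [two_mul (∑ v, _)]
    nth_rewrite 2 [e1]
    rw [e2, e1, adjBilin_apply', Finset.mul_sum, ← Finset.sum_add_distrib]
    refine Finset.sum_le_sum fun v _ => ?_
    rw [Finset.mul_sum, ← Finset.sum_add_distrib]
    refine Finset.sum_le_sum fun w _ => ?_
    split_ifs
    · nlinarith [sq_nonneg (x v - x w)]
    · simp
  have h2 : ∑ v, (G.degree v : ℝ) * (x v * x v) ≤ D * (x ⬝ᵥ x) := by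
    rw [dotProduct, Finset.mul_sum]
    refine Finset.sum_le_sum fun v _ => ?_
    by_cases hv : x v = 0
    · simp [hv]
    · exact mul_le_mul_of_nonneg_right (by exact_mod_cast h v hv) (mul_self_nonneg _)
  linarith

end Forms

/-! ### Inequalities obtained from explicit test vectors. -/

section TestVectors

open scoped Classical

variable {V : Type*} [Fintype V]

/-- Testing positivity on a star, balanced by a constant vector. -/
lemma star_test (G : SimpleGraph V) (hG : (seidelGram G).PosSemidef) (D : ℕ)
    (hD : ∀ v, G.degree v ≤ D) (v : V) (hv : G.degree v = D) (s : ℝ) (hs : 0 ≤ s) :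
    0 ≤ 2 * s ^ 2 + 2 * D - 2 * s * D + (s + D) ^ 2 * (2 * D - 2) / Fintype.card V := by
  set n : ℝ := (Fintype.card V : ℝ) with hn
  have hn0 : 0 < n := by
    rw [hn]; exact_mod_cast Fintype.card_pos_iff.mpr ⟨v⟩
  -- This weight makes the coordinate sum of the test vector zero, which removes the `J` term.
  set β : ℝ := (s + D) / n with hβ
  have hβ0 : 0 ≤ β := by positivity
  have hβn : β * n = s + D := by rw [hβ]; field_simp
  set N := G.neighborFinset v with hN
  have hNc : (N.card : ℝ) = D := by rw [hN, SimpleGraph.card_neighborFinset_eq_degree, hv]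
  have b1 : adjBilin G (indVec {v}) (indVec {v}) = 0 := by
    rw [adjBilin_indVec_indVec]; simp
  have b2 : adjBilin G (indVec {v}) (indVec N) = D := by
    rw [adjBilin_indVec_indVec]; simpa [← hN] using hNc
  have b3 : 0 ≤ adjBilin G (indVec N) (indVec N) :=
    adjBilin_nonneg G (indVec_nonneg _) (indVec_nonneg _)
  have b4 : adjBilin G (indVec {v}) (indVec Finset.univ) = D := by
    rw [adjBilin_indVec_indVec]; simpa [← hN] using hv
  have b5 : adjBilin G (indVec N) (indVec Finset.univ) ≤ D * D := by
    rw [adjBilin_indVec_indVec]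
    calc ∑ u ∈ N, ((G.neighborFinset u ∩ Finset.univ).card : ℝ) ≤ ∑ u ∈ N, (D : ℝ) := by
          refine Finset.sum_le_sum fun u _ => ?_
          simpa using hD u
      _ = D * D := by rw [Finset.sum_const, nsmul_eq_mul, hNc]
  have b6 : 0 ≤ adjBilin G (indVec Finset.univ) (indVec Finset.univ) :=
    adjBilin_nonneg G (indVec_nonneg _) (indVec_nonneg _)
  have hvN : ({v} : Finset V) ∩ N = ∅ := by simp [hN]
  have hNv : N ∩ ({v} : Finset V) = ∅ := by rw [Finset.inter_comm, hvN]
  have key := adjBilin_le G hG (s • indVec {v} + indVec N - β • indVec Finset.univ)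
  simp only [map_add, map_sub, map_smul, LinearMap.add_apply, LinearMap.sub_apply,
    LinearMap.smul_apply, smul_eq_mul, add_dotProduct, sub_dotProduct, smul_dotProduct,
    dotProduct_add, dotProduct_sub, dotProduct_smul, indVec_dot_indVec, Pi.add_apply, Pi.sub_apply,
    Pi.smul_apply, Finset.sum_add_distrib, Finset.sum_sub_distrib, ← Finset.mul_sum, sum_indVec,
    adjBilin_comm G (indVec N) (indVec {v}), adjBilin_comm G (indVec Finset.univ) (indVec {v}),
    adjBilin_comm G (indVec Finset.univ) (indVec N), b1, b2, b4, hvN, hNv, Finset.inter_univ,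
    Finset.univ_inter, Finset.inter_self, Finset.card_singleton, hNc, Finset.card_univ,
    Finset.card_empty, Nat.cast_one, Nat.cast_zero, ← hn] at key
  have e1 : (s + D) ^ 2 * (2 * D - 2) / n = β * (s + D) * (2 * D - 2) := by
    rw [hβ]; field_simp
  rw [e1]
  have h6 : 0 ≤ β * (β * adjBilin G (indVec Finset.univ) (indVec Finset.univ)) := by positivity
  have h5 := mul_le_mul_of_nonneg_left b5 hβ0
  have hsum : s * 1 + D - β * n = 0 := by linarith
  rw [hsum] at key
  have hβ2 : β * (β * n) = β * (s + D) := by rw [hβn]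
  nlinarith

/-- The number of neighbours of a vertex in an independent set is small or large. -/
lemma indep_nbr_bound (G : SimpleGraph V) (hG : (seidelGram G).PosSemidef) (I : Finset V)
    (hI : ∀ a ∈ I, ∀ b ∈ I, ¬ G.Adj a b) (y : V) (hy : y ∉ I) (r : ℝ)
    (hr : ((G.neighborFinset y ∩ I).card : ℝ) = r) : r * (I.card - r) ≤ 4 * I.card + 20 := by
  set m : ℝ := (I.card : ℝ) with hm
  have hm0 : 0 ≤ m := by positivity
  set N := G.neighborFinset y ∩ I with hN
  -- The minimizer in `b` of the quadratic form at `1_y + (1/2) 1_N + b 1_I`.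
  set b : ℝ := -(2 + r) / (2 * (m + 4)) with hb
  have hbm : b * (m + 4) = -(2 + r) / 2 := by rw [hb]; field_simp
  have b1 : adjBilin G (indVec {y}) (indVec {y}) = 0 := by
    rw [adjBilin_indVec_indVec]; simp
  have b2 : adjBilin G (indVec {y}) (indVec N) = r := by
    rw [adjBilin_indVec_indVec]; simp only [Finset.sum_singleton, hN]
    rw [← Finset.inter_assoc, Finset.inter_self]; exact hr
  have b3 : adjBilin G (indVec {y}) (indVec I) = r := by
    rw [adjBilin_indVec_indVec]; simpa [← hN] using hr
  have hII : ∀ s ⊆ I, ∀ t ⊆ I, adjBilin G (indVec s) (indVec t) = 0 := fun s hs t ht => by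
    refine adjBilin_eq_zero G fun v w hvw hv => ?_
    by_contra hw
    exact hI v (hs (by by_contra h; simp [indVec, h] at hv)) w
      (ht (by by_contra h; simp [indVec, h] at hw)) hvw
  have hNI : N ⊆ I := Finset.inter_subset_right
  have hyI : ({y} : Finset V) ∩ I = ∅ := by simp [hy]
  have hyN : ({y} : Finset V) ∩ N = ∅ := by simp [hN]
  have key := adjBilin_le G hG (indVec {y} + (1 / 2 : ℝ) • indVec N + b • indVec I)
  simp only [map_add, map_smul, LinearMap.add_apply,
    LinearMap.smul_apply, smul_eq_mul, add_dotProduct, smul_dotProduct,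
    dotProduct_add, dotProduct_smul, indVec_dot_indVec, Pi.add_apply,
    Pi.smul_apply, Finset.sum_add_distrib, ← Finset.mul_sum, sum_indVec,
    adjBilin_comm G (indVec N) (indVec {y}), adjBilin_comm G (indVec I) (indVec {y}),
    b1, b2, b3, hII N hNI N hNI, hII N hNI I subset_rfl, hII I subset_rfl N hNI,
    hII I subset_rfl I subset_rfl, Finset.inter_comm _ ({y} : Finset V), hyI, hyN,
    Finset.inter_self, Finset.inter_comm I N, Finset.inter_eq_left.mpr hNI,
    Finset.card_singleton, hr, ← hm,
    Finset.card_empty, Nat.cast_one, Nat.cast_zero] at key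
  have h1 : b * m = -(2 + r) / 2 - 4 * b := by linarith
  have hsum : 1 + 1 / 2 * r + b * m = -4 * b := by rw [h1]; ring
  rw [hsum] at key
  have h2 : b * (b * m) = b * (-(2 + r) / 2 - 4 * b) := by rw [h1]
  have h3 : 0 ≤ 4 - r - 2 * b * (r + 2) := by nlinarith
  have h4 := mul_nonneg h3 (by linarith : 0 ≤ m + 4)
  nlinarith

/-- Testing positivity on a star with leaves `Q`, balanced by a set `I`. -/
lemma star_balanced_test (G : SimpleGraph V) (hG : (seidelGram G).PosSemidef) (I Q : Finset V)
    (p : V) (hpI : ∀ a ∈ I, ¬ G.Adj p a) (hQ : ∀ a ∈ Q, G.Adj p a) (hQI : Disjoint Q I) (R : ℝ)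
    (hR : ∑ y ∈ Q, ((G.neighborFinset y ∩ I).card : ℝ) ≤ R) :
    (Q.card : ℝ) * (Q.card * I.card) ≤ Q.card * (5 * I.card + 5 * Q.card + 5 * R) := by
  set m : ℝ := (I.card : ℝ) with hm
  set q : ℝ := (Q.card : ℝ) with hq
  have hq0 : 0 ≤ q := by positivity
  rcases (Nat.cast_nonneg I.card : (0 : ℝ) ≤ I.card).eq_or_lt with hm0 | hm0
  · have hR0 : 0 ≤ R := le_trans (Finset.sum_nonneg fun _ _ => by positivity) hR
    rw [hm, ← hm0]
    have : 0 ≤ q * (5 * 0 + 5 * q + 5 * R) := by positivity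
    linarith
  rw [← hm] at hm0
  -- The mass on `I` cancels that of `Q`, so only the centre contributes to the coordinate sum.
  set β : ℝ := q / m with hβ
  have hβ0 : 0 ≤ β := by positivity
  have hβm : β * m = q := by rw [hβ]; field_simp
  have b1 : adjBilin G (indVec {p}) (indVec {p}) = 0 := by
    rw [adjBilin_indVec_indVec]; simp
  have b2 : adjBilin G (indVec {p}) (indVec Q) = q := by
    rw [adjBilin_indVec_indVec, Finset.sum_singleton, Finset.inter_eq_right.mpr]
    intro a ha; simpa using hQ a ha
  have b3 : 0 ≤ adjBilin G (indVec Q) (indVec Q) :=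
    adjBilin_nonneg G (indVec_nonneg _) (indVec_nonneg _)
  have b4 : adjBilin G (indVec {p}) (indVec I) = 0 := by
    rw [adjBilin_indVec_indVec, Finset.sum_singleton, Nat.cast_eq_zero, Finset.card_eq_zero,
      ← Finset.disjoint_iff_inter_eq_empty, Finset.disjoint_right]
    intro a ha; simpa using hpI a ha
  have b5 : adjBilin G (indVec Q) (indVec I) ≤ R := by rwa [adjBilin_indVec_indVec]
  have b6 : 0 ≤ adjBilin G (indVec I) (indVec I) :=
    adjBilin_nonneg G (indVec_nonneg _) (indVec_nonneg _)
  have hpQ : ({p} : Finset V) ∩ Q = ∅ := by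
    rw [Finset.singleton_inter_of_notMem]; exact fun h => G.irrefl (hQ p h)
  have hQI' : Q ∩ I = ∅ := Finset.disjoint_iff_inter_eq_empty.mp hQI
  -- With centre weight `s q`, the `q²` terms not involving `β` amount to `5s² - 4s`, which is least
  -- at `s = 2/5`.
  have key := adjBilin_le G hG ((2 / 5 * q) • indVec {p} + indVec Q - β • indVec I)
  simp only [map_add, map_sub, map_smul, LinearMap.add_apply, LinearMap.sub_apply,
    LinearMap.smul_apply, smul_eq_mul, add_dotProduct, sub_dotProduct, smul_dotProduct,
    dotProduct_add, dotProduct_sub, dotProduct_smul, indVec_dot_indVec, Pi.add_apply, Pi.sub_apply,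
    Pi.smul_apply, Finset.sum_add_distrib, Finset.sum_sub_distrib, ← Finset.mul_sum, sum_indVec,
    adjBilin_comm G (indVec Q) (indVec {p}), adjBilin_comm G (indVec I) (indVec {p}),
    adjBilin_comm G (indVec I) (indVec Q), b1, b2, b4, hpQ, Finset.inter_comm _ ({p} : Finset V),
    hQI', Finset.inter_comm I Q,
    Finset.inter_self, Finset.card_singleton, Finset.card_empty, Nat.cast_one, Nat.cast_zero,
    ← hm, ← hq] at key
  have h6 : 0 ≤ β * (β * adjBilin G (indVec I) (indVec I)) := by positivity
  have h5 := mul_le_mul_of_nonneg_left b5 hβ0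
  have hsum : 2 / 5 * q * 1 + q - β * m = 2 / 5 * q := by linarith
  rw [hsum] at key
  have hβ2 : β * (β * m) = β * q := by rw [hβm]
  have hc : (0 : ℝ) ≤ (({p} ∩ I).card : ℝ) := by positivity
  have hc' : 0 ≤ β * (q * (({p} ∩ I).card : ℝ)) := by positivity
  have main : 2 / 5 * (q * q) ≤ 2 * q + 2 * (β * q) + 2 * (β * R) := by nlinarith
  have h7 := mul_le_mul_of_nonneg_right main hm0.le
  have e2 : β * q * m = q * q := by rw [mul_right_comm, hβm]
  have e3 : β * R * m = q * R := by rw [mul_right_comm, hβm]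
  nlinarith

/-- Two non-adjacent parts cannot both have adjacency form exceeding twice the norm. -/
lemma adjBilin_le_of_separated (G : SimpleGraph V) (hG : (seidelGram G).PosSemidef) {x y : V → ℝ}
    (hx : 0 < ∑ v, x v) (hxx : 2 * (x ⬝ᵥ x) ≤ adjBilin G x x)
    (hdisj : ∀ v, x v ≠ 0 → y v = 0) (hadj : ∀ v w, G.Adj v w → x v ≠ 0 → y w = 0) :
    adjBilin G y y ≤ 2 * (y ⬝ᵥ y) := by
  have b1 : adjBilin G x y = 0 := adjBilin_eq_zero G hadj
  have d1 : x ⬝ᵥ y = 0 := Finset.sum_eq_zero fun v _ => by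
    by_cases h : x v = 0
    · simp [h]
    · simp [hdisj v h]
  -- The combination of `x` and `y` with coordinate sum zero; the cross terms vanish by separation.
  have key := adjBilin_le G hG ((∑ v, y v) • x - (∑ v, x v) • y)
  simp only [map_sub, map_smul, LinearMap.sub_apply,
    LinearMap.smul_apply, smul_eq_mul, sub_dotProduct, smul_dotProduct,
    dotProduct_sub, dotProduct_smul, Pi.sub_apply,
    Pi.smul_apply, Finset.sum_sub_distrib, ← Finset.mul_sum,
    adjBilin_comm G y x, dotProduct_comm y x, b1, d1] at key
  set a := ∑ v, x v
  set c := ∑ v, y v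
  have h1 := mul_le_mul_of_nonneg_left hxx (sq_nonneg c)
  have h2 : a ^ 2 * adjBilin G y y ≤ a ^ 2 * (2 * (y ⬝ᵥ y)) := by nlinarith
  exact le_of_mul_le_mul_left h2 (by positivity)

end TestVectors

/-! ### The nullity when the adjacency form is at most twice the norm. -/

section Rank

open scoped Classical

variable {V : Type*} [Fintype V]

lemma SimpleGraph.CliqueFree.not_adj_of_adj_adj {V : Type*} {G : SimpleGraph V} (h : G.CliqueFree 3) {a b c : V}
    (hab : G.Adj a b) (hac : G.Adj a c) : ¬ G.Adj b c := fun hbc =>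
  h {a, b, c} (SimpleGraph.is3Clique_triple_iff.mpr ⟨hab, hac, hbc⟩)

/-- A vector attaining equality in `xᵀ A x ≤ 2 |x|²` satisfies the eigenvector equation. -/
lemma sum_neighbor_of_extremal (G : SimpleGraph V)
    (h : ∀ x, adjBilin G x x ≤ 2 * (x ⬝ᵥ x)) {x : V → ℝ} (hx : adjBilin G x x = 2 * (x ⬝ᵥ x))
    (v : V) : ∑ w ∈ G.neighborFinset v, x w = 2 * x v := by
  have b1 : adjBilin G (indVec {v}) x = ∑ w ∈ G.neighborFinset v, x w := by
    rw [adjBilin_indVec, Finset.sum_singleton]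
  have b2 : adjBilin G (indVec {v}) (indVec {v}) = 0 := by
    rw [adjBilin_indVec_indVec]; simp
  have d1 : indVec {v} ⬝ᵥ x = x v := by rw [dot_indVec, Finset.sum_singleton]
  set d := ∑ w ∈ G.neighborFinset v, x w - 2 * x v with hd
  -- First-order optimality at `x`: moving by `d/2` in direction `v` would violate the bound by
  -- `d²/2`.
  have key := h (x + (d / 2) • indVec {v})
  simp only [map_add, map_smul, LinearMap.add_apply, LinearMap.smul_apply, smul_eq_mul,
    add_dotProduct, smul_dotProduct, dotProduct_add, dotProduct_smul, indVec_dot_indVec,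
    adjBilin_comm G x (indVec {v}), dotProduct_comm x (indVec {v}), b1, b2, d1,
    Finset.inter_self, Finset.card_singleton, Nat.cast_one, hx] at key
  have h1 : ∑ w ∈ G.neighborFinset v, x w = d + 2 * x v := by rw [hd]; ring
  rw [h1] at key ⊢
  have : d ^ 2 ≤ 0 := by nlinarith
  have : d = 0 := by nlinarith [sq_nonneg d]
  rw [this]; ring

/-- Taking absolute values preserves the norm and cannot lower the form, so extremality survives.
This supplies the nonnegative eigenvector of the Perron-Frobenius argument. -/
lemma extremal_abs (G : SimpleGraph V)
    (h : ∀ x, adjBilin G x x ≤ 2 * (x ⬝ᵥ x)) {x : V → ℝ} (hx : adjBilin G x x = 2 * (x ⬝ᵥ x)) :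
    adjBilin G (fun v => |x v|) (fun v => |x v|)
      = 2 * ((fun v => |x v|) ⬝ᵥ (fun v => |x v|)) := by
  refine le_antisymm (h _) ?_
  have e : (fun v => |x v|) ⬝ᵥ (fun v => |x v|) = x ⬝ᵥ x := by
    simp [dotProduct, abs_mul_abs_self]
  rw [e, ← hx, adjBilin_apply', adjBilin_apply']
  refine Finset.sum_le_sum fun v _ => Finset.sum_le_sum fun w _ => ?_
  split_ifs
  · rw [← abs_mul]; exact le_abs_self _
  · exact le_rfl

/-- At a zero of `y` the neighbour sum vanishes, so by nonnegativity every neighbour is a zero too;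
zeros spread along walks. -/
lemma eq_zero_of_reachable (G : SimpleGraph V) {y : V → ℝ} (hy : ∀ v, 0 ≤ y v)
    (hA : ∀ v, ∑ w ∈ G.neighborFinset v, y w = 2 * y v) {v w : V} (hvw : G.Reachable v w)
    (hv : y v = 0) : y w = 0 := by
  obtain ⟨p⟩ := hvw
  induction p with
  | nil => exact hv
  | @cons a b c hab _ ih =>
    refine ih ?_
    have h := hA a
    rw [hv, mul_zero, Finset.sum_eq_zero_iff_of_nonneg fun w _ => hy w] at h
    exact h b (by simpa using hab)

/-- A vertex where `y` is maximal on the component has degree at least 2. With degree 3 or more its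
closed neighbourhood suffices. With degree 2 both neighbours are maximal as well, and one of them
has a further neighbour, which is new since there are no triangles. -/
lemma four_le_card_component (G : SimpleGraph V) (hG : G.CliqueFree 3) {y : V → ℝ}
    (hy : ∀ v, 0 ≤ y v) (hA : ∀ v, ∑ w ∈ G.neighborFinset v, y w = 2 * y v) {v₀ : V}
    (hv₀ : y v₀ ≠ 0) :
    4 ≤ (Finset.univ.filter fun w => G.connectedComponentMk w = G.connectedComponentMk v₀).card := by
  set C := Finset.univ.filter fun w => G.connectedComponentMk w = G.connectedComponentMk v₀ with hC
  have hnb : ∀ {a b : V}, a ∈ C → G.Adj a b → b ∈ C := fun {a b} ha hab => by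
    simp only [hC, Finset.mem_filter, Finset.mem_univ, true_and] at ha ⊢
    rw [← ha]; exact (SimpleGraph.ConnectedComponent.sound hab.reachable).symm
  obtain ⟨v, hvC, hmax⟩ := C.exists_max_image y ⟨v₀, by simp [hC]⟩
  have hvpos : 0 < y v :=
    lt_of_lt_of_le (lt_of_le_of_ne (hy v₀) (Ne.symm hv₀)) (hmax v₀ (by simp [hC]))
  have hle : ∀ w ∈ G.neighborFinset v, y w ≤ y v := fun w hw =>
    hmax w (hnb hvC (by simpa using hw))
  have hdeg : 2 ≤ (G.neighborFinset v).card := by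
    have h1 := Finset.sum_le_card_nsmul _ _ _ hle
    rw [hA v, nsmul_eq_mul] at h1
    have : (2 : ℝ) ≤ (G.neighborFinset v).card := le_of_mul_le_mul_right h1 hvpos
    exact_mod_cast this
  have hsub : insert v (G.neighborFinset v) ⊆ C := by
    intro w hw
    rcases Finset.mem_insert.mp hw with rfl | hw
    · exact hvC
    · exact hnb hvC (by simpa using hw)
  rcases hdeg.eq_or_lt with h2 | h3
  · obtain ⟨a, b, hab, hN⟩ := Finset.card_eq_two.mp h2.symm
    have hva : G.Adj v a := by
      rw [← SimpleGraph.mem_neighborFinset, hN]; simp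
    have hvb : G.Adj v b := by
      rw [← SimpleGraph.mem_neighborFinset, hN]; simp
    have hs := hA v
    rw [hN, Finset.sum_pair hab] at hs
    have ha := hle a (by simpa using hva)
    have hb := hle b (by simpa using hvb)
    have hya : y a = y v := by linarith
    obtain ⟨c, hac, hcv⟩ : ∃ c, G.Adj a c ∧ c ≠ v := by
      by_contra! hcon
      have hNa : G.neighborFinset a = {v} := by
        ext c
        simp only [SimpleGraph.mem_neighborFinset, Finset.mem_singleton]
        exact ⟨hcon c, fun h => h ▸ hva.symm⟩
      have := hA a
      rw [hNa, Finset.sum_singleton] at this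
      linarith
    have hcb : c ≠ b := fun h => hG.not_adj_of_adj_adj hva hvb (h ▸ hac)
    have hcard : ({v, a, b, c} : Finset V).card = 4 := by
      rw [Finset.card_insert_of_notMem, Finset.card_insert_of_notMem, Finset.card_pair hcb.symm]
      · simp [hab, hac.ne]
      · simp [hva.ne, hvb.ne, hcv.symm]
    rw [← hcard]
    refine Finset.card_le_card fun w hw => ?_
    simp only [Finset.mem_insert, Finset.mem_singleton] at hw
    rcases hw with rfl | rfl | rfl | rfl
    · exact hvC
    · exact hnb hvC hva
    · exact hnb hvC hvb
    · exact hnb (hnb hvC hva) hac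
  · calc 4 ≤ (insert v (G.neighborFinset v)).card := by
          rw [Finset.card_insert_of_notMem (by simp)]; omega
      _ ≤ C.card := Finset.card_le_card hsub

/-- If the adjacency form of a triangle-free graph is at most twice the norm, then the Gram matrix
has rank at least three quarters of the order. -/
theorem rank_seidelGram_of_adjBilin_le (G : SimpleGraph V) (hG : G.CliqueFree 3)
    (h : ∀ x, adjBilin G x x ≤ 2 * (x ⬝ᵥ x)) :
    3 * Fintype.card V ≤ 4 * (seidelGram G).rank := by
  set K := LinearMap.ker (seidelGram G).mulVecLin with hK
  have hker : ∀ x ∈ K, adjBilin G x x = 2 * (x ⬝ᵥ x) := fun x hx => by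
    have h1 : (seidelGram G).mulVec x = 0 := by simpa [hK] using hx
    have h2 := dot_seidelGram G x
    rw [h1, dotProduct_zero] at h2
    nlinarith [h x, sq_nonneg (∑ v, x v)]
  set big : G.ConnectedComponent → Prop := fun c =>
    4 ≤ (Finset.univ.filter fun w => G.connectedComponentMk w = c).card with hbig
  -- Evaluation at one representative of each component with at least four vertices. A kernel vector
  -- vanishing at a representative vanishes on its whole component, and it is zero on all smaller
  -- components.
  let ev : K →ₗ[ℝ] ({c // big c} → ℝ) :=
    { toFun := fun x c => (x : V → ℝ) (Quot.out c.1)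
      map_add' := fun _ _ => rfl
      map_smul' := fun _ _ => rfl }
  have hinj : Function.Injective ev := by
    rw [injective_iff_map_eq_zero]
    rintro ⟨x, hx⟩ hx0
    ext v
    by_contra hv
    have hA := sum_neighbor_of_extremal G h (extremal_abs G h (hker x hx))
    have hv' : |x v| ≠ 0 := abs_ne_zero.mpr hv
    have h4 := four_le_card_component G hG (fun w => abs_nonneg (x w)) hA hv'
    have h0 : x (Quot.out (G.connectedComponentMk v)) = 0 :=
      congrFun hx0 ⟨G.connectedComponentMk v, h4⟩
    have hre : G.Reachable (Quot.out (G.connectedComponentMk v)) v :=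
      SimpleGraph.ConnectedComponent.exact (Quot.out_eq _)
    exact hv' (eq_zero_of_reachable G (fun w => abs_nonneg (x w)) hA hre (by simp [h0]))
  have hdim : Module.finrank ℝ K ≤ Fintype.card {c // big c} := by
    have := LinearMap.finrank_le_finrank_of_injective hinj
    rwa [Module.finrank_fintype_fun_eq_card] at this
  have hcount : 4 * Fintype.card {c // big c} ≤ Fintype.card V := by
    have h1 := Finset.card_nsmul_le_sum (Finset.univ.filter big)
      (fun c => (Finset.univ.filter fun w => G.connectedComponentMk w = c).card) 4
      (fun c hc => (Finset.mem_filter.mp hc).2)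
    have h2 : ∑ c ∈ Finset.univ.filter big,
        (Finset.univ.filter fun w => G.connectedComponentMk w = c).card ≤ Fintype.card V := by
      rw [← Finset.card_univ, Finset.card_eq_sum_card_fiberwise
        (f := G.connectedComponentMk) (t := Finset.univ) (by simp)]
      exact Finset.sum_le_sum_of_subset (Finset.filter_subset _ _)
    have h3 : Fintype.card {c // big c} = (Finset.univ.filter big).card :=
      Fintype.card_of_subtype _ (by simp)
    rw [smul_eq_mul] at h1
    omega
  have hrn := LinearMap.finrank_range_add_finrank_ker (seidelGram G).mulVecLin
  rw [Module.finrank_fintype_fun_eq_card] at hrn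
  have : (seidelGram G).rank + Module.finrank ℝ K = Fintype.card V := hrn
  omega

end Rank

/-! ### Deleting few vertices to bring the adjacency form down to twice the norm. -/

section Deletion

open scoped Classical

variable {V : Type*} [Fintype V]

/-- The vertices at distance at most two from `v`. -/
noncomputable def ballTwo (G : SimpleGraph V) (v : V) : Finset V :=
  insert v ((G.neighborFinset v).biUnion fun a => insert a ((G.neighborFinset a).erase v))

lemma self_mem_ballTwo (G : SimpleGraph V) (v : V) : v ∈ ballTwo G v := by simp [ballTwo]

lemma mem_ballTwo_of_adj {G : SimpleGraph V} {v a : V} (h : G.Adj v a) : a ∈ ballTwo G v := by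
  simp only [ballTwo, Finset.mem_insert, Finset.mem_biUnion, SimpleGraph.mem_neighborFinset]
  exact Or.inr ⟨a, h, Or.inl rfl⟩

lemma mem_ballTwo_of_adj_adj {G : SimpleGraph V} {v a b : V} (h : G.Adj v a) (h' : G.Adj a b) :
    b ∈ ballTwo G v := by
  by_cases hb : b = v
  · rw [hb]; exact self_mem_ballTwo G v
  simp only [ballTwo, Finset.mem_insert, Finset.mem_biUnion, SimpleGraph.mem_neighborFinset,
    Finset.mem_erase]
  exact Or.inr ⟨a, h, Or.inr ⟨hb, h'⟩⟩

lemma card_ballTwo_le (G : SimpleGraph V) (D : ℕ) (hD : ∀ v, G.degree v ≤ D) (v : V) :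
    (ballTwo G v).card ≤ D * D + 1 := by
  refine (Finset.card_insert_le _ _).trans (Nat.succ_le_succ ?_)
  refine (Finset.card_biUnion_le_card_mul _ _ D fun a ha => ?_).trans
    (Nat.mul_le_mul_right _ (by simpa using hD v))
  have hva : v ∈ G.neighborFinset a := by
    rw [SimpleGraph.mem_neighborFinset] at ha ⊢; exact ha.symm
  have h1 := Finset.card_erase_add_one hva
  have h2 := hD a
  rw [← SimpleGraph.card_neighborFinset_eq_degree] at h2
  exact (Finset.card_insert_le _ _).trans (by omega)

/-- The part of `y` on `P` is controlled by degrees at most 2, the part off `P` by its separation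
from `x`, and no edge joins the two. Here `P` lets vertices of the support of `x` survive the
deletion. -/
lemma adjBilin_le_of_split (G : SimpleGraph V) (hG : (seidelGram G).PosSemidef) {x y : V → ℝ}
    (P : V → Prop) (hx : 0 < ∑ v, x v) (hxx : 2 * (x ⬝ᵥ x) ≤ adjBilin G x x)
    (hdeg : ∀ v, P v → y v ≠ 0 → G.degree v ≤ 2)
    (hnb : ∀ v w, G.Adj v w → P v → y v ≠ 0 → P w)
    (hdisj : ∀ v, x v ≠ 0 → ¬ P v → y v = 0)
    (hadj : ∀ v w, G.Adj v w → x v ≠ 0 → ¬ P w → y w = 0) :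
    adjBilin G y y ≤ 2 * (y ⬝ᵥ y) := by
  set a : V → ℝ := fun v => if P v then y v else 0 with ha
  set b : V → ℝ := fun v => if P v then 0 else y v with hb
  have hy : y = a + b := by
    ext v; by_cases h : P v <;> simp [ha, hb, h]
  have hab : adjBilin G a b = 0 := by
    refine adjBilin_eq_zero G fun v w hvw hv => ?_
    have hPv : P v := by by_contra h; simp [ha, h] at hv
    have hyv : y v ≠ 0 := by simpa [ha, hPv] using hv
    simp [hb, hnb v w hvw hPv hyv]
  have dab : a ⬝ᵥ b = 0 := Finset.sum_eq_zero fun v _ => by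
    by_cases h : P v <;> simp [ha, hb, h]
  have haa : adjBilin G a a ≤ 2 * (a ⬝ᵥ a) := by
    refine adjBilin_self_le_degree G 2 a fun v hv => ?_
    have hPv : P v := by by_contra h; simp [ha, h] at hv
    exact hdeg v hPv (by simpa [ha, hPv] using hv)
  have hbb : adjBilin G b b ≤ 2 * (b ⬝ᵥ b) := by
    refine adjBilin_le_of_separated G hG hx hxx (fun v hv => ?_) (fun v w hvw hv => ?_)
    · by_cases h : P v
      · simp [hb, h]
      · simpa [hb, h] using hdisj v hv h
    · by_cases h : P w
      · simp [hb, h]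
      · simpa [hb, h] using hadj v w hvw hv h
  rw [hy]
  simp only [map_add, LinearMap.add_apply, add_dotProduct, dotProduct_add, adjBilin_comm G b a,
    dotProduct_comm b a, hab, dab]
  linarith

/-- The vector with 2 at `v` and 1 on its neighbours, the eigenvector of the extended diagram of
type `D₄`, already reaches twice the norm; outside the ball of radius two everything is separated
from it. -/
lemma exists_deletion_of_four_le_degree (G : SimpleGraph V) (hG : (seidelGram G).PosSemidef)
    (v : V) (hv : 4 ≤ G.degree v) :
    ∀ y : V → ℝ, (∀ w ∈ ballTwo G v, y w = 0) → adjBilin G y y ≤ 2 * (y ⬝ᵥ y) := by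
  intro y hy
  set N := G.neighborFinset v with hN
  have hNc : (4 : ℝ) ≤ N.card := by
    rw [hN, SimpleGraph.card_neighborFinset_eq_degree]; exact_mod_cast hv
  have b1 : adjBilin G (indVec {v}) (indVec {v}) = 0 := by
    rw [adjBilin_indVec_indVec]; simp
  have b2 : adjBilin G (indVec {v}) (indVec N) = N.card := by
    rw [adjBilin_indVec_indVec]; simp [← hN]
  have b3 : 0 ≤ adjBilin G (indVec N) (indVec N) :=
    adjBilin_nonneg G (indVec_nonneg _) (indVec_nonneg _)
  have hvN : ({v} : Finset V) ∩ N = ∅ := by simp [hN]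
  have hNv : N ∩ ({v} : Finset V) = ∅ := by rw [Finset.inter_comm, hvN]
  have hmem : ∀ w, ((2 : ℝ) • indVec {v} + indVec N : V → ℝ) w ≠ 0 → w = v ∨ G.Adj v w := by
    intro w hw
    by_contra! h
    refine hw ?_
    simp [indVec, h.1, hN, h.2]
  refine adjBilin_le_of_split G hG (x := (2 : ℝ) • indVec {v} + indVec N) (fun _ => False) ?_ ?_
    (fun _ h => h.elim) (fun _ _ _ h => h.elim) (fun w hw _ => ?_) (fun a w haw ha _ => ?_)
  · simp only [Pi.add_apply, Pi.smul_apply, smul_eq_mul, Finset.sum_add_distrib, ← Finset.mul_sum,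
      sum_indVec, Finset.card_singleton, Nat.cast_one]
    linarith
  · simp only [map_add, map_smul, LinearMap.add_apply, LinearMap.smul_apply, smul_eq_mul,
      add_dotProduct, smul_dotProduct, dotProduct_add, dotProduct_smul, indVec_dot_indVec,
      adjBilin_comm G (indVec N) (indVec {v}), b1, b2, hvN, hNv, Finset.inter_self,
      Finset.card_singleton, Finset.card_empty, Nat.cast_one, Nat.cast_zero]
    linarith
  · rcases hmem w hw with rfl | h
    · exact hy _ (self_mem_ballTwo G _)
    · exact hy _ (mem_ballTwo_of_adj h)
  · rcases hmem a ha with rfl | h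
    · exact hy _ (mem_ballTwo_of_adj haw)
    · exact hy _ (mem_ballTwo_of_adj_adj h haw)

lemma exists_adj_dist_add_one {V : Type*} (G : SimpleGraph V) {u z : V} (h : G.Reachable u z) (hne : u ≠ z) :
    ∃ a, G.Adj z a ∧ G.Reachable u a ∧ G.dist u a + 1 = G.dist u z := by
  obtain ⟨p, hp⟩ := h.symm.exists_walk_length_eq_dist
  cases p with
  | nil => exact absurd rfl hne
  | @cons _ a _ hza q =>
    refine ⟨a, hza, ⟨q.reverse⟩, ?_⟩
    rw [SimpleGraph.Walk.length_cons, SimpleGraph.dist_comm] at hp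
    have h1 : G.dist u a ≤ q.length := by
      rw [SimpleGraph.dist_comm]; exact SimpleGraph.dist_le q
    obtain ⟨r, hr⟩ := (show G.Reachable u a from ⟨q.reverse⟩).exists_walk_length_eq_dist
    have h2 : G.dist u z ≤ (r.concat hza.symm).length := SimpleGraph.dist_le _
    rw [SimpleGraph.Walk.length_concat] at h2
    omega

/-- Two branch vertices joined by a geodesic without branch vertices in its interior. -/
lemma exists_deletion_of_branch_pair (G : SimpleGraph V) (hG : (seidelGram G).PosSemidef)
    (u u' : V) (hne : u ≠ u') (hu : 3 ≤ G.degree u) (hu' : 3 ≤ G.degree u')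
    (hr : G.Reachable u u')
    (hmin : ∀ z, G.Reachable u z → z ≠ u → G.dist u z < G.dist u u' → G.degree z ≤ 2) :
    ∀ y : V → ℝ, (∀ w ∈ ballTwo G u ∪ ballTwo G u', y w = 0) →
      adjBilin G y y ≤ 2 * (y ⬝ᵥ y) := by
  intro y hy
  have hyu : ∀ w ∈ ballTwo G u, y w = 0 := fun w hw => hy w (Finset.mem_union_left _ hw)
  have hyu' : ∀ w ∈ ballTwo G u', y w = 0 := fun w hw => hy w (Finset.mem_union_right _ hw)
  -- The vertices on geodesics from `u` to `u'`. Interior ones have exactly two neighbours, both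
  -- again in `P`, so a geodesic of any length need not be deleted.
  set P : V → Prop := fun z => G.Reachable u z ∧ G.dist u z + G.dist z u' = G.dist u u' with hP
  have hPu : P u := ⟨SimpleGraph.Reachable.refl _, by simp⟩
  have hPu' : P u' := ⟨hr, by simp⟩
  have htri : ∀ z, G.Reachable u z → G.dist u u' ≤ G.dist u z + G.dist z u' := fun z hz => by
    obtain ⟨p, hp⟩ := hz.exists_walk_length_eq_dist
    obtain ⟨q, hq⟩ := (hz.symm.trans hr).exists_walk_length_eq_dist
    have := SimpleGraph.dist_le (p.append q)
    rw [SimpleGraph.Walk.length_append] at this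
    omega
  have hstep : ∀ {a b c : V}, G.Reachable c a → G.Adj a b → G.dist c b ≤ G.dist c a + 1 :=
    fun {a b c} hca hab => by
      obtain ⟨p, hp⟩ := hca.exists_walk_length_eq_dist
      have := SimpleGraph.dist_le (p.concat hab)
      rw [SimpleGraph.Walk.length_concat] at this
      omega
  have hfwd : ∀ z, P z → z ≠ u' → ∃ b, G.Adj z b ∧ P b ∧ G.dist u b = G.dist u z + 1 := by
    rintro z ⟨hz, hzd⟩ hzne
    obtain ⟨b, hzb, hb, hbd⟩ := exists_adj_dist_add_one G (hr.symm.trans hz) hzne.symm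
    have h1 := hstep hz hzb
    have hub := hz.trans hzb.reachable
    have h2 := htri b hub
    rw [G.dist_comm (u := u') (v := b), G.dist_comm (u := u') (v := z)] at hbd
    exact ⟨b, hzb, ⟨hub, by omega⟩, by omega⟩
  have hbwd : ∀ z, P z → z ≠ u → ∃ a, G.Adj z a ∧ P a ∧ G.dist u a + 1 = G.dist u z := by
    rintro z ⟨hz, hzd⟩ hzne
    obtain ⟨a, hza, ha, had⟩ := exists_adj_dist_add_one G hz hzne.symm
    have h1 := hstep (hr.symm.trans hz) hza
    have h2 := htri a ha
    rw [G.dist_comm (u := u') (v := a), G.dist_comm (u := u') (v := z)] at h1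
    exact ⟨a, hza, ⟨ha, by omega⟩, had⟩
  have hdeg : ∀ z, P z → z ≠ u → z ≠ u' → G.degree z ≤ 2 := by
    rintro z ⟨hz, hzd⟩ h1 h2
    have := (hz.symm.trans hr).pos_dist_of_ne h2
    exact hmin z hz h1 (by omega)
  have hnb : ∀ z, P z → z ≠ u → z ≠ u' → ∃ a b, a ≠ b ∧ P a ∧ P b ∧
      G.neighborFinset z = {a, b} := by
    intro z hz h1 h2
    obtain ⟨b, hzb, hPb, hb⟩ := hfwd z hz h2
    obtain ⟨a, hza, hPa, ha⟩ := hbwd z hz h1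
    have hab : a ≠ b := by rintro rfl; omega
    refine ⟨a, b, hab, hPa, hPb, (Finset.eq_of_subset_of_card_le ?_ ?_).symm⟩
    · intro c hc
      rcases Finset.mem_insert.mp hc with rfl | hc
      · simpa using hza
      · rw [Finset.mem_singleton.mp hc]; simpa using hzb
    · rw [Finset.card_pair hab]; simpa using hdeg z hz h1 h2
  -- The eigenvector for the eigenvalue 2 of an extended diagram of type `D`: 2 along the path, 1 on
  -- the leaves at both ends.
  set x : V → ℝ := fun v => if P v then 2 else if G.Adj u v ∨ G.Adj u' v then 1 else 0 with hx
  have hx0 : ∀ v, 0 ≤ x v := fun v => by simp only [hx]; split_ifs <;> norm_num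
  have hxP : ∀ v, P v → x v = 2 := fun v hv => by simp [hx, hv]
  have hx1 : ∀ v, G.Adj u v ∨ G.Adj u' v → 1 ≤ x v := fun v hv => by
    simp only [hx, hv]; split_ifs <;> norm_num
  have hend : ∀ z, 3 ≤ G.degree z → (∀ w, G.Adj z w → 1 ≤ x w) → (∃ a, G.Adj z a ∧ P a) →
      4 ≤ ∑ w ∈ G.neighborFinset z, x w := by
    rintro z hz h1 ⟨a, hza, hPa⟩
    have ha : a ∈ G.neighborFinset z := by simpa using hza
    rw [← Finset.add_sum_erase _ _ ha, hxP a hPa]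
    have h2 := Finset.card_nsmul_le_sum ((G.neighborFinset z).erase a) x 1 fun w hw =>
      h1 w (by simpa using Finset.mem_of_mem_erase hw)
    have h3 := Finset.card_erase_add_one ha
    rw [SimpleGraph.card_neighborFinset_eq_degree] at h3
    have h4 : (2 : ℝ) ≤ ((G.neighborFinset z).erase a).card := by
      exact_mod_cast (by omega : 2 ≤ ((G.neighborFinset z).erase a).card)
    simp only [nsmul_eq_mul, mul_one] at h2
    linarith
  have hmem : ∀ v, x v ≠ 0 → P v ∨ G.Adj u v ∨ G.Adj u' v := by
    intro v hv
    by_contra h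
    push Not at h
    exact hv (by simp [hx, h.1, h.2.1, h.2.2])
  have hAx : ∀ v, x v ≠ 0 → 2 * x v ≤ ∑ w ∈ G.neighborFinset v, x w := by
    intro v hv
    by_cases hPv : P v
    · rw [hxP v hPv]
      by_cases h1 : v = u
      · subst h1
        obtain ⟨b, hb, hPb, _⟩ := hfwd v hPv hne
        have := hend v hu (fun w hw => hx1 w (Or.inl hw)) ⟨b, hb, hPb⟩
        linarith
      by_cases h2 : v = u'
      · subst h2
        obtain ⟨b, hb, hPb, _⟩ := hbwd v hPv h1
        have := hend v hu' (fun w hw => hx1 w (Or.inr hw)) ⟨b, hb, hPb⟩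
        linarith
      obtain ⟨a, b, hab, hPa, hPb, hN⟩ := hnb v hPv h1 h2
      rw [hN, Finset.sum_pair hab, hxP a hPa, hxP b hPb]
      norm_num
    · have hadj : G.Adj u v ∨ G.Adj u' v := (hmem v hv).resolve_left hPv
      have hxv : x v = 1 := by simp [hx, hPv, hadj]
      rw [hxv]
      rcases hadj with h | h
      · calc (2 * 1 : ℝ) = x u := by rw [hxP u hPu]; norm_num
          _ ≤ _ := Finset.single_le_sum (fun w _ => hx0 w) (by simpa using h.symm)
      · calc (2 * 1 : ℝ) = x u' := by rw [hxP u' hPu']; norm_num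
          _ ≤ _ := Finset.single_le_sum (fun w _ => hx0 w) (by simpa using h.symm)
  have hneu : ∀ v, y v ≠ 0 → v ≠ u ∧ v ≠ u' := fun v hv =>
    ⟨fun h => hv (hyu v (h ▸ self_mem_ballTwo G u)),
      fun h => hv (hyu' v (h ▸ self_mem_ballTwo G u'))⟩
  have hnbP : ∀ v w, G.Adj v w → P v → v ≠ u → v ≠ u' → P w := by
    intro v w hvw hPv h1 h2
    obtain ⟨a, b, -, hPa, hPb, hN⟩ := hnb v hPv h1 h2
    have hw : w ∈ G.neighborFinset v := by simpa using hvw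
    rw [hN] at hw
    rcases Finset.mem_insert.mp hw with rfl | hw
    · exact hPa
    · rwa [Finset.mem_singleton.mp hw]
  refine adjBilin_le_of_split G hG (x := x) P ?_ ?_ ?_ ?_ ?_ ?_
  · exact Finset.sum_pos' (fun v _ => hx0 v) ⟨u, Finset.mem_univ _, by rw [hxP u hPu]; norm_num⟩
  · rw [adjBilin_apply, dotProduct, Finset.mul_sum]
    refine Finset.sum_le_sum fun v _ => ?_
    by_cases hv : x v = 0
    · simp [hv]
    · have := mul_le_mul_of_nonneg_left (hAx v hv) (hx0 v)
      linarith
  · exact fun v hPv hv => hdeg v hPv (hneu v hv).1 (hneu v hv).2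
  · exact fun v w hvw hPv hv => hnbP v w hvw hPv (hneu v hv).1 (hneu v hv).2
  · intro v hv hPv
    rcases hmem v hv with h | h | h
    · exact absurd h hPv
    · exact hyu v (mem_ballTwo_of_adj h)
    · exact hyu' v (mem_ballTwo_of_adj h)
  · intro v w hvw hv hPw
    rcases hmem v hv with h | h | h
    · by_cases h1 : v = u
      · subst h1; exact hyu w (mem_ballTwo_of_adj hvw)
      by_cases h2 : v = u'
      · subst h2; exact hyu' w (mem_ballTwo_of_adj hvw)
      exact absurd (hnbP v w hvw h h1 h2) hPw
    · exact hyu w (mem_ballTwo_of_adj_adj h hvw)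
    · exact hyu' w (mem_ballTwo_of_adj_adj h hvw)

/-- When every component has at most one branch vertex, one deletion suffices. -/
lemma exists_deletion_of_isolated_branches (G : SimpleGraph V) (hG : (seidelGram G).PosSemidef)
    (hb : ∀ u u', 3 ≤ G.degree u → 3 ≤ G.degree u' → G.Reachable u u' → u = u') :
    ∃ T : Finset V, T.card ≤ 1 ∧
      ∀ y : V → ℝ, (∀ w ∈ T, y w = 0) → adjBilin G y y ≤ 2 * (y ⬝ᵥ y) := by
  by_cases hall : ∀ y, adjBilin G y y ≤ 2 * (y ⬝ᵥ y)
  · exact ⟨∅, by simp, fun y _ => hall y⟩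
  push Not at hall
  obtain ⟨x₀, hx₀⟩ := hall
  set x : V → ℝ := fun v => |x₀ v| with hx
  have hx0 : ∀ v, 0 ≤ x v := fun v => abs_nonneg _
  have hxx : 2 * (x ⬝ᵥ x) < adjBilin G x x := by
    have e : x ⬝ᵥ x = x₀ ⬝ᵥ x₀ := by simp [hx, dotProduct, abs_mul_abs_self]
    rw [e]
    refine hx₀.trans_le ?_
    rw [adjBilin_apply', adjBilin_apply']
    refine Finset.sum_le_sum fun v _ => Finset.sum_le_sum fun w _ => ?_
    split_ifs
    · simp only [hx]; rw [← abs_mul]; exact le_abs_self _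
    · exact le_rfl
  set g : V → ℝ := fun v => 2 * (x v * x v) - x v * ∑ w ∈ G.neighborFinset v, x w with hg
  have hgneg : ∑ v, g v < 0 := by
    simp only [hg]
    rw [Finset.sum_sub_distrib, ← adjBilin_apply, ← Finset.mul_sum]
    have : ∑ v, x v * x v = x ⬝ᵥ x := rfl
    linarith
  -- The deficit of a violating vector is a sum over components, so one component already carries a
  -- violation. The other components are separated from it, and inside it only a branch vertex can
  -- have degree above 2.
  obtain ⟨c, hc⟩ : ∃ c : G.ConnectedComponent,
      ∑ v with G.connectedComponentMk v = c, g v < 0 := by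
    by_contra! hcon
    rw [← Finset.sum_fiberwise Finset.univ G.connectedComponentMk g] at hgneg
    exact absurd (Finset.sum_nonneg fun c _ => hcon c) (not_le.mpr hgneg)
  set z : V → ℝ := fun v => if G.connectedComponentMk v = c then x v else 0 with hz
  have hz0 : ∀ v, 0 ≤ z v := fun v => by simp only [hz]; split_ifs <;> simp [hx0]
  have hcadj : ∀ v w, G.Adj v w → (G.connectedComponentMk v = c ↔ G.connectedComponentMk w = c) :=
    fun v w hvw => by rw [SimpleGraph.ConnectedComponent.sound hvw.reachable]
  have hzc : ∀ v, z v ≠ 0 → G.connectedComponentMk v = c := fun v hv => by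
    by_contra h; simp [hz, h] at hv
  have hzz : 2 * (z ⬝ᵥ z) - adjBilin G z z < 0 := by
    refine lt_of_eq_of_lt ?_ hc
    rw [adjBilin_apply, dotProduct, Finset.mul_sum, ← Finset.sum_sub_distrib, Finset.sum_filter]
    refine Finset.sum_congr rfl fun v _ => ?_
    by_cases h : G.connectedComponentMk v = c
    · have hs : ∑ w ∈ G.neighborFinset v, z w = ∑ w ∈ G.neighborFinset v, x w :=
        Finset.sum_congr rfl fun w hw => by
          simp [hz, (hcadj v w (by simpa using hw)).mp h]
      simp only [hs, h, if_true, hg]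
      simp [hz, h]
    · simp [hz, h]
  refine ⟨Finset.univ.filter fun v => G.connectedComponentMk v = c ∧ 3 ≤ G.degree v, ?_, ?_⟩
  · refine Finset.card_le_one.mpr fun a ha b hb' => ?_
    simp only [Finset.mem_filter, Finset.mem_univ, true_and] at ha hb'
    exact hb a b ha.2 hb'.2 (SimpleGraph.ConnectedComponent.exact (ha.1.trans hb'.1.symm))
  · intro y hy
    refine adjBilin_le_of_split G hG (x := z) (fun v => G.connectedComponentMk v = c) ?_
      (by linarith) ?_ ?_ ?_ ?_
    · refine lt_of_le_of_ne (Finset.sum_nonneg fun v _ => hz0 v) fun h0 => ?_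
      have h1 : z = 0 := funext fun v =>
        (Finset.sum_eq_zero_iff_of_nonneg fun v _ => hz0 v).mp h0.symm v (Finset.mem_univ _)
      rw [h1] at hzz
      simp at hzz
    · intro v hv hyv
      by_contra h
      exact hyv (hy v (by simp only [Finset.mem_filter, Finset.mem_univ, true_and]
                          exact ⟨hv, by omega⟩))
    · exact fun v w hvw hv _ => (hcadj v w hvw).mp hv
    · exact fun v hv h => absurd (hzc v hv) h
    · exact fun v w hvw hv h => absurd ((hcadj v w hvw).mp (hzc v hv)) h

/-- Deleting at most twenty vertices from a graph of maximum degree at most four makes the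
adjacency form at most twice the norm. -/
theorem exists_deletion (G : SimpleGraph V) (hG : (seidelGram G).PosSemidef)
    (hD : ∀ v, G.degree v ≤ 4) :
    ∃ T : Finset V, T.card ≤ 20 ∧
      ∀ y : V → ℝ, (∀ w ∈ T, y w = 0) → adjBilin G y y ≤ 2 * (y ⬝ᵥ y) := by
  by_cases h4 : ∃ v, 4 ≤ G.degree v
  · obtain ⟨v, hv⟩ := h4
    exact ⟨ballTwo G v, (card_ballTwo_le G 4 hD v).trans (by norm_num),
      exists_deletion_of_four_le_degree G hG v hv⟩
  have h3 : ∀ v, G.degree v ≤ 3 := fun v => by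
    by_contra h; exact h4 ⟨v, by omega⟩
  by_cases hpair : ∃ ℓ, ∃ u u', u ≠ u' ∧ 3 ≤ G.degree u ∧ 3 ≤ G.degree u' ∧ G.Reachable u u' ∧
      G.dist u u' = ℓ
  · obtain ⟨u, u', hne, hu, hu', hr, hd⟩ := Nat.find_spec hpair
    refine ⟨ballTwo G u ∪ ballTwo G u', ?_,
      exists_deletion_of_branch_pair G hG u u' hne hu hu' hr fun z hz hzu hlt => ?_⟩
    -- Each ball has at most `3 · 3 + 1 = 10` vertices, whence the bound 20.
    · have h1 := card_ballTwo_le G 3 h3 u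
      have h2 := card_ballTwo_le G 3 h3 u'
      exact (Finset.card_union_le _ _).trans (by omega)
    · by_contra h
      exact Nat.find_min hpair (hd ▸ hlt) ⟨u, z, hzu.symm, hu, by omega, hz, rfl⟩
  · push Not at hpair
    obtain ⟨T, hT, h⟩ := exists_deletion_of_isolated_branches G hG fun u u' hu hu' hr => by
      by_contra hne
      exact hpair _ u u' hne hu hu' hr rfl
    exact ⟨T, hT.trans (by norm_num), h⟩

end Deletion

/-! ### The case of moderate degrees, and switching. -/

section Rank

open scoped Classical

lemma seidelGram_comap {V W : Type*} (G : SimpleGraph V) (f : W ↪ V) :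
    seidelGram (G.comap f) = (seidelGram G).submatrix f f := by
  ext v w
  simp [seidelGram]

variable {V : Type*} [Fintype V]

lemma adjBilin_comap {W : Type*} [Fintype W] (G : SimpleGraph V) (f : W ↪ V) (y : V → ℝ)
    (hy : ∀ v, v ∉ Set.range f → y v = 0) :
    adjBilin (G.comap f) (y ∘ f) (y ∘ f) = adjBilin G y y := by
  rw [adjBilin_apply', adjBilin_apply']
  refine Fintype.sum_of_injective f f.injective _ _ (fun v hv => ?_) fun v => ?_
  · simp [hy v hv]
  · refine Fintype.sum_of_injective f f.injective _ _ (fun w hw => ?_) fun w => ?_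
    · simp [hy w hw]
    · simp

lemma three_mul_card_le_of_degree_le_four (G : SimpleGraph V) (hG : (seidelGram G).PosSemidef)
    (hfree : G.CliqueFree 3) (hD : ∀ v, G.degree v ≤ 4) :
    3 * Fintype.card V ≤ 4 * (seidelGram G).rank + 60 := by
  obtain ⟨T, hT, h⟩ := exists_deletion G hG hD
  let f : {v // v ∉ T} ↪ V := Function.Embedding.subtype _
  have h1 := rank_seidelGram_of_adjBilin_le (G.comap f)
    (hfree.comap ⟨(SimpleGraph.Embedding.comap f G).toCopy⟩) fun (x : {v // v ∉ T} → ℝ) => by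
      set y : V → ℝ := Function.extend f x (0 : V → ℝ) with hy
      have hyx : y ∘ f = x := funext fun v => f.injective.extend_apply x (0 : V → ℝ) v
      have hy0 : ∀ v, v ∉ Set.range f → y v = 0 := fun v hv =>
        Function.extend_apply' x (0 : V → ℝ) v fun ⟨a, ha⟩ => hv ⟨a, ha⟩
      rw [← hyx, adjBilin_comap G f y hy0]
      have hd : (y ∘ f) ⬝ᵥ (y ∘ f) = y ⬝ᵥ y :=
        Fintype.sum_of_injective f f.injective _ _ (fun v hv => by simp [hy0 v hv]) fun v => rfl
      rw [hd]
      refine h y fun w hw => hy0 w ?_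
      rintro ⟨a, rfl⟩
      exact a.2 hw
  rw [seidelGram_comap] at h1
  have h2 := Matrix.rank_submatrix_le (seidelGram G) f f
  have h3 : Fintype.card {v // v ∉ T} = Fintype.card V - T.card := by
    rw [Fintype.card_of_subtype Tᶜ (by simp), Finset.card_compl]
  omega

/-- A graph with many vertices and moderate degrees has maximum degree at most four. -/
lemma degree_le_four (G : SimpleGraph V) (hG : (seidelGram G).PosSemidef)
    (hn : 271 ≤ Fintype.card V) (hD : ∀ v, G.degree v ≤ 28) (u : V) : G.degree u ≤ 4 := by
  obtain ⟨v, -, hv⟩ := Finset.univ.exists_max_image (fun v => G.degree v) ⟨u, Finset.mem_univ u⟩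
  refine (hv u (Finset.mem_univ u)).trans ?_
  by_contra! h5
  -- With `s = D/4 + 1` the main term is `D + 2 - 3D²/8`, which vanishes at `D = 4`. The error term
  -- needs `s` small: at 271 vertices this choice excludes every `D` from 5 to 28 but no longer 29.
  have key := star_test G hG (G.degree v) (fun w => hv w (Finset.mem_univ w)) v rfl
    (G.degree v / 4 + 1) (by positivity)
  have h28 := hD v
  have hn' : (271 : ℝ) ≤ Fintype.card V := by exact_mod_cast hn
  generalize G.degree v = D at *
  have hD1 : (0 : ℝ) ≤ 2 * D - 2 := by
    have : (5 : ℝ) ≤ D := by exact_mod_cast h5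
    linarith
  have h2 : ((D : ℝ) / 4 + 1 + D) ^ 2 * (2 * D - 2) / Fintype.card V
      ≤ ((D : ℝ) / 4 + 1 + D) ^ 2 * (2 * D - 2) / 271 := by
    gcongr
  have h3 := key.trans (add_le_add_right h2 _)
  clear key h2 hD1 hv hD
  interval_cases D <;> norm_num at h3

/-- The graph obtained by switching with respect to a finite set of vertices. -/
def switchAt (G : SimpleGraph V) (U : Finset V) : SimpleGraph V where
  Adj a b := a ≠ b ∧ (G.Adj a b ↔ (a ∈ U ↔ b ∈ U))
  symm := ⟨fun a b h => ⟨h.1.symm, by rw [G.adj_comm, h.2]; exact iff_comm⟩⟩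
  loopless := ⟨fun _ h => h.1 rfl⟩

lemma seidelGram_switchAt (G : SimpleGraph V) (U : Finset V) :
    seidelGram (switchAt G U) = Matrix.diagonal (fun v => if v ∈ U then (-1 : ℝ) else 1)
      * seidelGram G * Matrix.diagonal (fun v => if v ∈ U then (-1 : ℝ) else 1) := by
  ext a b
  rw [Matrix.mul_diagonal, Matrix.diagonal_mul]
  by_cases hab : a = b
  · subst hab; by_cases ha : a ∈ U <;> simp [seidelGram, ha]
  · by_cases ha : a ∈ U <;> by_cases hb : b ∈ U <;> by_cases h : G.Adj a b <;>
      simp [seidelGram, switchAt, ha, hb, h, hab]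

lemma rank_seidelGram_switchAt_le (G : SimpleGraph V) (U : Finset V) :
    (seidelGram (switchAt G U)).rank ≤ (seidelGram G).rank := by
  rw [seidelGram_switchAt]
  exact (Matrix.rank_mul_le_left _ _).trans (Matrix.rank_mul_le_right _ _)

lemma posSemidef_seidelGram_switchAt (G : SimpleGraph V) (hG : (seidelGram G).PosSemidef)
    (U : Finset V) : (seidelGram (switchAt G U)).PosSemidef := by
  rw [seidelGram_switchAt]
  have h := hG.mul_mul_conjTranspose_same
    (Matrix.diagonal (fun v => if v ∈ U then (-1 : ℝ) else 1))
  rwa [Matrix.diagonal_conjTranspose, star_trivial] at h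

end Rank

/-! ### The case of a vertex of large degree. -/

section LargeDegree

open scoped Classical

variable {V : Type*} [Fintype V]

/-- The number of neighbours of `y` in `I`. -/
noncomputable def nbrCount (G : SimpleGraph V) (I : Finset V) (y : V) : ℕ :=
  (G.neighborFinset y ∩ I).card

/-- The vertices outside `I` with at most `t` neighbours in `I`. -/
noncomputable def lowPart (G : SimpleGraph V) (I : Finset V) (t : ℕ) : Finset V :=
  Finset.univ.filter fun y => y ∉ I ∧ nbrCount G I y ≤ t

/-- The vertices outside `I` with at most `t` non-neighbours in `I`. -/
noncomputable def highPart (G : SimpleGraph V) (I : Finset V) (t : ℕ) : Finset V :=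
  Finset.univ.filter fun y => y ∉ I ∧ I.card ≤ nbrCount G I y + t

lemma mem_lowPart {G : SimpleGraph V} {I : Finset V} {t : ℕ} {y : V} :
    y ∈ lowPart G I t ↔ y ∉ I ∧ nbrCount G I y ≤ t := by simp [lowPart]

lemma mem_highPart {G : SimpleGraph V} {I : Finset V} {t : ℕ} {y : V} :
    y ∈ highPart G I t ↔ y ∉ I ∧ I.card ≤ nbrCount G I y + t := by simp [highPart]

lemma sum_nbrCount_comm (G : SimpleGraph V) (I J : Finset V) :
    ∑ y ∈ J, nbrCount G I y = ∑ a ∈ I, nbrCount G J a := by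
  have h := adjBilin_comm G (indVec J) (indVec I)
  rw [adjBilin_indVec_indVec, adjBilin_indVec_indVec] at h
  exact_mod_cast h

lemma notMem_highPart_of_mem_lowPart {G : SimpleGraph V} {I : Finset V} {t : ℕ}
    (ht : 2 * t < I.card) {y : V} (hy : y ∈ lowPart G I t) : y ∉ highPart G I t := by
  rw [mem_lowPart] at hy
  rw [mem_highPart]
  intro h
  omega

/-- Double counting of the edges between `I` and the high part: at most `m²` from the side of `I`,
at least `m - t` at each high vertex. -/
lemma card_highPart_mul_le (G : SimpleGraph V) (I : Finset V) (t m : ℕ) (hm : I.card = m)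
    (hD : ∀ u, G.degree u ≤ m) :
    (highPart G I t).card * m ≤ m * m + (highPart G I t).card * t := by
  have h1 : (highPart G I t).card * m ≤ ∑ y ∈ highPart G I t, (nbrCount G I y + t) := by
    rw [← smul_eq_mul]
    exact Finset.card_nsmul_le_sum _ _ _ fun y hy => hm ▸ (mem_highPart.mp hy).2
  rw [Finset.sum_add_distrib, sum_nbrCount_comm, Finset.sum_const, smul_eq_mul] at h1
  have h2 : ∑ a ∈ I, nbrCount G (highPart G I t) a ≤ m * m := by
    have := Finset.sum_le_card_nsmul I (nbrCount G (highPart G I t)) m fun a _ =>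
      (Finset.card_le_card Finset.inter_subset_left).trans (by simpa using hD a)
    rwa [smul_eq_mul, hm] at this
  omega

/-- The hypothesis says that `r(m - r)` exceeds `4m + 20` at `r = t + 1`, where `m` is the size of
`I`. By concavity it does so on all of `[t + 1, m - t - 1]`, so `indep_nbr_bound` forbids these
neighbour counts. -/
lemma card_le_of_dichotomy (G : SimpleGraph V) (hG : (seidelGram G).PosSemidef) (I : Finset V) (hI : ∀ a ∈ I, ∀ b ∈ I, ¬ G.Adj a b) (t : ℕ)
    (ht : 5 * I.card + 20 < (t + 1) * (I.card - (t + 1) : ℤ) + I.card) :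
    Fintype.card V ≤ I.card + (lowPart G I t).card + (highPart G I t).card := by
  have hcov : (Finset.univ : Finset V) ⊆ I ∪ lowPart G I t ∪ highPart G I t := by
    intro y _
    by_contra h
    simp only [Finset.mem_union, mem_lowPart, mem_highPart, not_or, not_and, not_le] at h
    obtain ⟨⟨hyI, h1⟩, h2⟩ := h
    have h1 := h1 hyI
    have h2 := h2 hyI
    have key := indep_nbr_bound G hG I hI y hyI _ rfl
    change (nbrCount G I y : ℝ) * (I.card - nbrCount G I y) ≤ _ at key
    have key' : (nbrCount G I y : ℤ) * (I.card - nbrCount G I y) ≤ 4 * I.card + 20 := by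
      exact_mod_cast key
    zify at h1 h2
    nlinarith [mul_nonneg (by linarith : (0 : ℤ) ≤ nbrCount G I y - (t + 1))
      (by linarith : (0 : ℤ) ≤ I.card - (t + 1) - nbrCount G I y)]
  have h1 := Finset.card_le_card hcov
  rw [Finset.card_univ] at h1
  have h2 := Finset.card_union_le (I ∪ lowPart G I t) (highPart G I t)
  have h3 := Finset.card_union_le I (lowPart G I t)
  omega

lemma switchAt_adj_iff_of_notMem {V : Type*} (G : SimpleGraph V) {U : Finset V} {a b : V} (ha : a ∉ U) (hb : b ∉ U) :
    (switchAt G U).Adj a b ↔ G.Adj a b := by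
  simp only [switchAt, ha, hb, iff_self, iff_true]
  exact ⟨fun h => h.2, fun h => ⟨h.ne, h⟩⟩

lemma switchAt_adj_iff_of_mem_of_mem {V : Type*} (G : SimpleGraph V) {U : Finset V} {a b : V} (ha : a ∈ U) (hb : b ∈ U) :
    (switchAt G U).Adj a b ↔ G.Adj a b := by
  simp only [switchAt, ha, hb, iff_self, iff_true]
  exact ⟨fun h => h.2, fun h => ⟨h.ne, h⟩⟩

lemma switchAt_adj_iff_of_mem {V : Type*} (G : SimpleGraph V) {U : Finset V} {a b : V} (ha : a ∈ U) (hb : b ∉ U) :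
    (switchAt G U).Adj a b ↔ ¬ G.Adj a b := by
  have hab : a ≠ b := fun h => hb (h ▸ ha)
  simp [switchAt, ha, hb, hab]

lemma nbrCount_switchAt (G : SimpleGraph V) {U I : Finset V} (hUI : ∀ a ∈ I, a ∉ U) {y : V} (hy : y ∉ U) :
    nbrCount (switchAt G U) I y = nbrCount G I y := by
  unfold nbrCount
  congr 1
  ext a
  simp only [Finset.mem_inter, SimpleGraph.mem_neighborFinset]
  exact and_congr_left fun ha => switchAt_adj_iff_of_notMem G hy (hUI a ha)

lemma nbrCount_switchAt_add (G : SimpleGraph V) {U I : Finset V} (hUI : ∀ a ∈ I, a ∉ U) {y : V} (hy : y ∈ U) :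
    nbrCount (switchAt G U) I y + nbrCount G I y = I.card := by
  have h : (switchAt G U).neighborFinset y ∩ I = I \ (G.neighborFinset y ∩ I) := by
    ext a
    simp only [Finset.mem_inter, SimpleGraph.mem_neighborFinset, Finset.mem_sdiff]
    constructor
    · rintro ⟨h, ha⟩
      exact ⟨ha, fun h' => (switchAt_adj_iff_of_mem G hy (hUI a ha)).mp h h'.1⟩
    · rintro ⟨ha, h⟩
      exact ⟨(switchAt_adj_iff_of_mem G hy (hUI a ha)).mpr fun h' => h ⟨h', ha⟩, ha⟩
  unfold nbrCount
  rw [h]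
  exact Finset.card_sdiff_add_card_eq_card Finset.inter_subset_right

lemma notMem_highPart_of_mem {I : Finset V} {t : ℕ} {a : V} (ha : a ∈ I) :
    a ∉ highPart G I t := fun h => (mem_highPart.mp h).1 ha

/-- Switching at the high part, which contains `v`, disconnects `v` from `I` and joins it to every
low vertex. The low part thus becomes the leaves of a star that can be balanced by `I`. -/
lemma card_lowPart_mul_le (G : SimpleGraph V) (hG : (seidelGram G).PosSemidef) (v : V) (m t R : ℕ) (hm : G.degree v = m) (ht : 2 * t < m)
    (hR : ∑ y ∈ lowPart G (G.neighborFinset v) t, nbrCount G (G.neighborFinset v) y ≤ R) :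
    (lowPart G (G.neighborFinset v) t).card * m
      ≤ 5 * m + 5 * (lowPart G (G.neighborFinset v) t).card + 5 * R := by
  set I := G.neighborFinset v with hI
  have hIm : I.card = m := by rw [hI, SimpleGraph.card_neighborFinset_eq_degree, hm]
  have hv : v ∈ highPart G I t := by
    rw [mem_highPart]
    refine ⟨by simp [hI], ?_⟩
    unfold nbrCount
    rw [← hI, Finset.inter_self]
    omega
  have hlow : ∀ y ∈ lowPart G I t, y ∉ highPart G I t := fun y hy =>
    notMem_highPart_of_mem_lowPart (by omega) hy
  have key := star_balanced_test (switchAt G (highPart G I t))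
    (posSemidef_seidelGram_switchAt G hG _) I (lowPart G I t) v
    (fun a ha => by
      rw [switchAt_adj_iff_of_mem G hv (notMem_highPart_of_mem ha), not_not]
      simpa [hI] using ha)
    (fun y hy => by
      rw [switchAt_adj_iff_of_mem G hv (hlow y hy)]
      have := (mem_lowPart.mp hy).1
      simpa [hI] using this)
    (Finset.disjoint_left.mpr fun y hy => (mem_lowPart.mp hy).1) R ?_
  · rcases Nat.eq_zero_or_pos (lowPart G I t).card with h0 | h0
    · rw [h0]; omega
    · have := le_of_mul_le_mul_left key (by exact_mod_cast h0)
      rw [hIm] at this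
      exact_mod_cast this
  · have h1 : ∑ y ∈ lowPart G I t, nbrCount (switchAt G (highPart G I t)) I y
        = ∑ y ∈ lowPart G I t, nbrCount G I y :=
      Finset.sum_congr rfl fun y hy =>
        nbrCount_switchAt G (fun a ha => notMem_highPart_of_mem ha) (hlow y hy)
    rw [← h1] at hR
    exact_mod_cast hR

lemma sum_nbrCount_lowPart_le (G : SimpleGraph V) (I : Finset V) (t : ℕ) :
    ∑ y ∈ lowPart G I t, nbrCount G I y ≤ (lowPart G I t).card * t :=
  Finset.sum_le_card_nsmul _ _ _ fun _ hy => (mem_lowPart.mp hy).2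

/-- Counted from `I`: each vertex there spends one of its at most `m` edges on `v`, which is not
low. -/
lemma sum_nbrCount_lowPart_le' (G : SimpleGraph V) (v : V) (m t : ℕ) (hm : G.degree v = m) (ht : t < m)
    (hD : ∀ u, G.degree u ≤ m) :
    ∑ y ∈ lowPart G (G.neighborFinset v) t, nbrCount G (G.neighborFinset v) y
      ≤ m * (m - 1) := by
  rw [sum_nbrCount_comm]
  have := Finset.sum_le_card_nsmul (G.neighborFinset v)
    (nbrCount G (lowPart G (G.neighborFinset v) t)) (m - 1) fun a ha => ?_
  · rwa [smul_eq_mul, SimpleGraph.card_neighborFinset_eq_degree, hm] at this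
  · have hva : v ∈ G.neighborFinset a := by
      rw [SimpleGraph.mem_neighborFinset] at ha ⊢; exact ha.symm
    have h1 : G.neighborFinset a ∩ lowPart G (G.neighborFinset v) t
        ⊆ (G.neighborFinset a).erase v := by
      intro y hy
      rw [Finset.mem_inter] at hy
      refine Finset.mem_erase.mpr ⟨?_, hy.1⟩
      rintro rfl
      have := (mem_lowPart.mp hy.2).2
      unfold nbrCount at this
      rw [Finset.inter_self, SimpleGraph.card_neighborFinset_eq_degree] at this
      omega
    have h2 := Finset.card_le_card h1
    rw [Finset.card_erase_of_mem hva, SimpleGraph.card_neighborFinset_eq_degree] at h2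
    have := hD a
    exact h2.trans (by omega)

lemma indep_neighborFinset (G : SimpleGraph V) (hfree : G.CliqueFree 3) (v : V) : ∀ a ∈ G.neighborFinset v, ∀ b ∈ G.neighborFinset v, ¬ G.Adj a b :=
  fun _ ha _ hb => hfree.not_adj_of_adj_adj (by simpa using ha) (by simpa using hb)

lemma forty_six_le_degree (G : SimpleGraph V) (hG : (seidelGram G).PosSemidef) (hfree : G.CliqueFree 3)
    (v : V) (hn : 277 ≤ Fintype.card V) (hD : ∀ u, G.degree u ≤ G.degree v)
    (hv : 29 ≤ G.degree v) : 46 ≤ G.degree v := by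
  by_contra! h46
  have hI := indep_neighborFinset G hfree v
  have hIm := SimpleGraph.card_neighborFinset_eq_degree G v
  obtain ⟨m, hm⟩ : ∃ m, G.degree v = m := ⟨_, rfl⟩
  -- The condition `6(m - 6) > 4m + 20` is exactly `m ≥ 29`.
  have h1 := card_le_of_dichotomy G hG _ hI 5 (by rw [hIm]; push_cast; omega)
  have h2 := card_highPart_mul_le G (G.neighborFinset v) 5 m (by omega) (by simpa [← hm] using hD)
  have h3 := card_lowPart_mul_le G hG v m 5 _ hm (by omega) (sum_nbrCount_lowPart_le G _ 5)
  have h4 := card_lowPart_mul_le G hG v m 5 _ hm (by omega)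
    -- The preceding bound is vacuous for `m ≤ 30`; this edge count covers those values.
    (sum_nbrCount_lowPart_le' G v m 5 hm (by omega) (by simpa [← hm] using hD))
  rw [hIm, hm] at h1
  rw [hm] at hv h46
  generalize (lowPart G (G.neighborFinset v) 5).card = q at *
  generalize (highPart G (G.neighborFinset v) 5).card = w at *
  clear hI hIm hm hD hfree hG
  interval_cases m <;> omega

lemma card_lowPart_le_six (G : SimpleGraph V) (hG : (seidelGram G).PosSemidef) (hfree : G.CliqueFree 3)
    (v : V) (hn : 277 ≤ Fintype.card V) (hD : ∀ u, G.degree u ≤ G.degree v)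
    (hv : 46 ≤ G.degree v) :
    (lowPart G (G.neighborFinset v) 4).card ≤ 6 ∧ 132 ≤ G.degree v := by
  have hI := indep_neighborFinset G hfree v
  have hIm := SimpleGraph.card_neighborFinset_eq_degree G v
  obtain ⟨m, hm⟩ : ∃ m, G.degree v = m := ⟨_, rfl⟩
  -- Here `5(m - 5) > 4m + 20` is exactly `m ≥ 46`.
  have h1 := card_le_of_dichotomy G hG _ hI 4 (by rw [hIm]; push_cast; omega)
  have h2 := card_highPart_mul_le G (G.neighborFinset v) 4 m (by omega) (by simpa [← hm] using hD)
  have h3 := card_lowPart_mul_le G hG v m 4 _ hm (by omega) (sum_nbrCount_lowPart_le G _ 4)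
  rw [hIm, hm] at h1
  rw [hm] at hv ⊢
  generalize (lowPart G (G.neighborFinset v) 4).card = q at *
  generalize (highPart G (G.neighborFinset v) 4).card = w at *
  have hw : w ≤ m + 4 := by
    by_contra! h
    nlinarith [Nat.mul_le_mul_left m h]
  have hq : q ≤ 10 := by
    by_contra! h
    nlinarith
  -- From `277 ≤ m + 10 + (m + 4)`. Reinserted in `q(m - 25) ≤ 5m`, this improves 10 to 6.
  have hm132 : 132 ≤ m := by omega
  refine ⟨?_, hm132⟩
  by_contra! h
  nlinarith

/-- A triangle-free graph with a vertex of large degree is, up to switching and few vertices,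
the bipartite complement of a sparse bipartite graph. -/
lemma three_mul_card_le_of_large_degree (G : SimpleGraph V) (hG : (seidelGram G).PosSemidef)
    (hfree : G.CliqueFree 3) (v : V) (hn : 277 ≤ Fintype.card V)
    (hD : ∀ u, G.degree u ≤ G.degree v) (hv : 29 ≤ G.degree v) :
    3 * Fintype.card V ≤ 4 * (seidelGram G).rank + 78 := by
  have hv46 := forty_six_le_degree G hG hfree v hn hD hv
  obtain ⟨hq, hm⟩ := card_lowPart_le_six G hG hfree v hn hD hv46
  have hI := indep_neighborFinset G hfree v
  have hIm := SimpleGraph.card_neighborFinset_eq_degree G v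
  set I := G.neighborFinset v
  set L := lowPart G I 4 with hL
  set U := highPart G I 4 with hU
  have hUI : ∀ a ∈ I, a ∉ U := fun a ha => notMem_highPart_of_mem ha
  have hcov : ∀ y, y ∉ L → y ∉ I → y ∈ U := by
    intro y hyL hyI
    by_contra hyU
    have hL' : 4 < nbrCount G I y := by
      by_contra! h; exact hyL (mem_lowPart.mpr ⟨hyI, h⟩)
    have hU' : nbrCount G I y + 4 < I.card := by
      by_contra! h; exact hyU (mem_highPart.mpr ⟨hyI, h⟩)
    have key := indep_nbr_bound G hG I hI y hyI _ rfl
    change (nbrCount G I y : ℝ) * (I.card - nbrCount G I y) ≤ _ at key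
    have h5 : (5 : ℝ) ≤ nbrCount G I y := by exact_mod_cast hL'
    have h6 : (nbrCount G I y : ℝ) + 5 ≤ I.card := by exact_mod_cast hU'
    have h7 : (46 : ℝ) ≤ I.card := by rw [hIm]; exact_mod_cast hv46
    nlinarith [mul_nonneg (by linarith : (0 : ℝ) ≤ nbrCount G I y - 5)
      (by linarith : (0 : ℝ) ≤ I.card - 5 - nbrCount G I y)]
  -- Each vertex of `U` misses at most four vertices of `I`, so two of them have a common neighbour
  -- there; an edge between them would close a triangle.
  have hUU : ∀ a ∈ U, ∀ b ∈ U, ¬ G.Adj a b := by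
    intro a ha b hb hab
    have h1 := (mem_highPart.mp ha).2
    have h2 := (mem_highPart.mp hb).2
    unfold nbrCount at h1 h2
    obtain ⟨c, hc⟩ : ((G.neighborFinset a ∩ I) ∩ (G.neighborFinset b ∩ I)).Nonempty := by
      refine Finset.inter_nonempty_of_card_lt_card_add_card (s := I) Finset.inter_subset_right
        Finset.inter_subset_right ?_
      omega
    simp only [Finset.mem_inter, SimpleGraph.mem_neighborFinset] at hc
    exact hfree.not_adj_of_adj_adj hab hc.1.1 hc.2.1
  set G' := switchAt G U with hG'
  have hpsd : (seidelGram G').PosSemidef := posSemidef_seidelGram_switchAt G hG U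
  let f : {y // y ∉ L} ↪ V := Function.Embedding.subtype _
  set H := G'.comap f with hH
  have hHpsd : (seidelGram H).PosSemidef := by
    rw [hH, seidelGram_comap]; exact hpsd.submatrix f
  have hHcard : Fintype.card {y // y ∉ L} = Fintype.card V - L.card := by
    rw [Fintype.card_of_subtype Lᶜ (by simp), Finset.card_compl]
  have hbip : ∀ a b, H.Adj a b → (f a ∈ U ↔ f b ∉ U) := by
    intro a b hab
    have hab' : G'.Adj (f a) (f b) := hab
    by_cases ha : f a ∈ U <;> by_cases hb : f b ∈ U
    · exact absurd ((switchAt_adj_iff_of_mem_of_mem G ha hb).mp hab') (hUU _ ha _ hb)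
    · simp [ha, hb]
    · simp [ha, hb]
    · have haI : f a ∈ I := by by_contra h; exact ha (hcov _ a.2 h)
      have hbI : f b ∈ I := by by_contra h; exact hb (hcov _ b.2 h)
      exact absurd ((switchAt_adj_iff_of_notMem G ha hb).mp hab') (hI _ haI _ hbI)
  have hHfree : H.CliqueFree 3 := by
    intro s hs
    obtain ⟨a, b, c, hab, hac, hbc, -⟩ := SimpleGraph.is3Clique_iff.mp hs
    have h1 := hbip a b hab
    have h2 := hbip a c hac
    have h3 := hbip b c hbc
    tauto
  have hUcount : ∀ y ∈ U, nbrCount G' I y ≤ 4 := fun y hy => by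
    have h1 : nbrCount G' I y + nbrCount G I y = I.card := nbrCount_switchAt_add G hUI hy
    have h2 := (mem_highPart.mp hy).2
    omega
  have hHdeg : ∀ y, H.degree y ≤ 28 := by
    intro y
    rw [← SimpleGraph.card_neighborFinset_eq_degree]
    by_cases hy : f y ∈ U
    · have h1 : (H.neighborFinset y).card ≤ nbrCount G' I (f y) := by
        refine Finset.card_le_card_of_injOn f (fun z hz => ?_) f.injective.injOn
        have hyz : H.Adj y z := by simpa using hz
        have hzU : f z ∉ U := (hbip y z hyz).mp hy
        have hzI : f z ∈ I := by by_contra h; exact hzU (hcov _ z.2 h)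
        have : G'.Adj (f y) (f z) := hyz
        simp [this, hzI]
      have := hUcount _ hy
      omega
    · have hyI : f y ∈ I := by by_contra h; exact hy (hcov _ y.2 h)
      set Q := G'.neighborFinset (f y) ∩ U with hQ
      have h1 : (H.neighborFinset y).card ≤ Q.card := by
        refine Finset.card_le_card_of_injOn f (fun z hz => ?_) f.injective.injOn
        have hyz : H.Adj y z := by simpa using hz
        have hzU : f z ∈ U := by
          by_contra h; exact hy ((hbip y z hyz).mpr h)
        have : G'.Adj (f y) (f z) := hyz
        simp [hQ, this, hzU]
      have hQU : ∀ z ∈ Q, z ∈ U := fun z hz => (Finset.mem_inter.mp hz).2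
      -- The leaves have at most four neighbours each in `I` after switching, so this gives `q(m -
      -- 25) ≤ 5m`, impossible for `q ≥ 29` and `m ≥ 132`.
      have key := star_balanced_test G' hpsd I Q (f y)
        (fun a ha => by
          rw [switchAt_adj_iff_of_notMem G hy (hUI a ha)]; exact hI _ hyI _ ha)
        (fun a ha => by simpa using (Finset.mem_inter.mp ha).1)
        (Finset.disjoint_left.mpr fun z hz hzI => hUI z hzI (hQU z hz)) (Q.card * 4) ?_
      · have hmR : (132 : ℝ) ≤ I.card := by rw [hIm]; exact_mod_cast hm
        by_contra! h28
        have hQ28 : (29 : ℝ) ≤ Q.card := by exact_mod_cast (h28.trans_le h1)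
        have := le_of_mul_le_mul_left key (by linarith)
        nlinarith
      · have := Finset.sum_le_card_nsmul Q (nbrCount G' I) 4 fun z hz => hUcount z (hQU z hz)
        rw [smul_eq_mul] at this
        exact_mod_cast this
  -- At least `277 - 6 = 271` vertices remain.
  have h4 := degree_le_four H hHpsd (by omega) hHdeg
  have hfin := three_mul_card_le_of_degree_le_four H hHpsd hHfree h4
  rw [hHcard, hH, seidelGram_comap] at hfin
  have h5 := Matrix.rank_submatrix_le (seidelGram G') f f
  have h6 : (seidelGram G').rank ≤ (seidelGram G).rank := rank_seidelGram_switchAt_le G U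
  omega

theorem three_mul_card_le (G : SimpleGraph V) (hG : (seidelGram G).PosSemidef) (hfree : G.CliqueFree 3)
    (hn : 277 ≤ Fintype.card V) :
    3 * Fintype.card V ≤ 4 * (seidelGram G).rank + 78 := by
  have : Nonempty V := Fintype.card_pos_iff.mp (by omega)
  obtain ⟨v, -, hv⟩ := Finset.univ.exists_max_image (fun v => G.degree v) Finset.univ_nonempty
  rcases Nat.lt_or_ge 28 (G.degree v) with h | h
  · exact three_mul_card_le_of_large_degree G hG hfree v hn (fun u => hv u (Finset.mem_univ u)) h
  · have h4 := degree_le_four G hG (by omega) fun u => (hv u (Finset.mem_univ u)).trans h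
    have := three_mul_card_le_of_degree_le_four G hG hfree h4
    omega

end LargeDegree

/-! ### From Seidel matrices and switching classes to the Gram matrix of a graph. -/

section Main

open scoped Classical

lemma seidelOfGraph_apply {n : ℕ} (G : SimpleGraph (Fin n)) {i j : Fin n} (hij : i ≠ j) :
    seidelOfGraph G i j = if G.Adj i j then -1 else 1 := by
  by_cases h : G.Adj i j <;> simp [seidelOfGraph, SimpleGraph.adjMatrix_apply, hij, h] ; norm_num

lemma seidelOfGraph_graphOfSeidel {n : ℕ} {S : Matrix (Fin n) (Fin n) ℝ} (hS : IsSeidelMatrix S) :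
    seidelOfGraph (graphOfSeidel S) = S := by
  ext i j
  by_cases hij : i = j
  · subst hij
    simp [seidelOfGraph, hS.diag]
  · rw [seidelOfGraph_apply _ hij]
    have hsymm : S j i = S i j := hS.symm.apply i j
    rcases hS.off_diag i j hij with h | h
    · simp [graphOfSeidel, hij, hsymm, h]; norm_num
    · simp [graphOfSeidel, hij, hsymm, h]

lemma seidelGram_graphOfSeidel_switchMatrix {n : ℕ} {S : Matrix (Fin n) (Fin n) ℝ}
    (hS : IsSeidelMatrix S) (U : Set (Fin n)) :
    seidelGram (graphOfSeidel (switchMatrix S U)) = switchingDiagonal U *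
      (S + (5 : ℝ) • (1 : Matrix (Fin n) (Fin n) ℝ)) * switchingDiagonal U := by
  ext i j
  have hsymm : S j i = S i j := hS.symm.apply i j
  rw [switchingDiagonal, Matrix.mul_diagonal, Matrix.diagonal_mul]
  by_cases hij : i = j
  · subst hij
    by_cases hi : i ∈ U <;> simp [seidelGram, hS.diag, hi]
  · rcases hS.off_diag i j hij with h | h <;> by_cases hi : i ∈ U <;> by_cases hj : j ∈ U <;>
      simp [seidelGram, graphOfSeidel, switchMatrix, switchingDiagonal, hij, hsymm, h, hi, hj] <;>
      norm_num

lemma posSemidef_add_of_isSmallestEigenvalue {n : ℕ} {S : Matrix (Fin n) (Fin n) ℝ}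
    (hS : IsSeidelMatrix S) (hmin : IsSmallestEigenvalue S (-5)) :
    (S + (5 : ℝ) • (1 : Matrix (Fin n) (Fin n) ℝ)).PosSemidef := by
  have hT : S.IsHermitian := by
    rw [Matrix.IsHermitian, Matrix.conjTranspose_eq_transpose_of_trivial]; exact hS.symm
  have hH : (S + (5 : ℝ) • (1 : Matrix (Fin n) (Fin n) ℝ)).IsHermitian := by
    refine hT.add ?_
    rw [Matrix.IsHermitian, Matrix.conjTranspose_smul, Matrix.conjTranspose_one, star_trivial]
  rw [hH.posSemidef_iff_eigenvalues_nonneg]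
  intro i
  have hv := hH.mulVec_eigenvectorBasis i
  set w : Fin n → ℝ := ⇑(hH.eigenvectorBasis i)
  have hw0 : w ≠ 0 := fun h => hH.eigenvectorBasis.orthonormal.ne_zero i (by
    ext j; exact congrFun h j)
  have h5 : Module.End.HasEigenvalue (Matrix.toLin' S) (hH.eigenvalues i - 5) := by
    refine Module.End.hasEigenvalue_of_hasEigenvector (x := w)
      (Module.End.hasEigenvector_iff.mpr ⟨?_, hw0⟩)
    rw [Module.End.mem_eigenspace_iff, Matrix.toLin'_apply, sub_smul, ← hv, Matrix.add_mulVec,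
      Matrix.smul_mulVec, Matrix.one_mulVec, add_sub_cancel_right]
  have := hmin.2 h5
  simp only [Pi.zero_apply]
  linarith

end Main

theorem mainTheorem4 (n : ℕ) (hn : 277 ≤ n) (S : Matrix (Fin n) (Fin n) ℝ)
    (hS : IsSeidelMatrix S) (hmin : IsSmallestEigenvalue S (-5))
    (hG : ∃ G ∈ seidelSwitchingClass S, G.CliqueFree 3) :
    2 * (n : ℝ) / 3 + 1 ≤ ((S + (5 : ℝ) • (1 : Matrix (Fin n) (Fin n) ℝ)).rank : ℝ) := by
  obtain ⟨G, ⟨U, hGU⟩, hfree⟩ := hG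
  have hgram : seidelGram G = switchingDiagonal U *
      (S + (5 : ℝ) • (1 : Matrix (Fin n) (Fin n) ℝ)) * switchingDiagonal U := by
    rw [hGU, switchGraph, seidelOfGraph_graphOfSeidel hS]
    exact seidelGram_graphOfSeidel_switchMatrix hS U
  have hD : (switchingDiagonal U).conjTranspose = switchingDiagonal U := by
    rw [switchingDiagonal, Matrix.diagonal_conjTranspose, star_trivial]
  have hpsd : (seidelGram G).PosSemidef := by
    have h := (posSemidef_add_of_isSmallestEigenvalue hS hmin).mul_mul_conjTranspose_same
      (switchingDiagonal U)
    rwa [hD, ← hgram] at h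
  have hrank : (seidelGram G).rank ≤ (S + (5 : ℝ) • (1 : Matrix (Fin n) (Fin n) ℝ)).rank := by
    rw [hgram]
    exact (Matrix.rank_mul_le_left _ _).trans (Matrix.rank_mul_le_right _ _)
  have key := three_mul_card_le G hpsd hfree (by simpa using hn)
  rw [Fintype.card_fin] at key
  have h1 : (3 * n : ℝ) ≤ 4 * (seidelGram G).rank + 78 := by exact_mod_cast key
  have h2 : ((seidelGram G).rank : ℝ)
      ≤ (S + (5 : ℝ) • (1 : Matrix (Fin n) (Fin n) ℝ)).rank := by exact_mod_cast hrank
  have h3 : (277 : ℝ) ≤ n := by exact_mod_cast hn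
  -- The bound `3n ≤ 4 rk + 78` implies the claim as soon as `n ≥ 246`.
  linarith
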